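/- A double category with connections $\mathsf D$ is understood as edge-symmetric: it has sets $D_0,D_1,D_2$ of points, edges and squares, a category structure on $D_1$ over $D_0$ and two category structures $+_1$ (vertical), $+_2$ (horizontal) on $D_2$ over $D_1$, with faces $\partial_i^\pm$ and degeneracies $\varepsilon_i$, satisfying the cubical relations and the interchange law, and connections $\Gamma^-,\Gamma^+:D_1\to D_2$ (where $\Gamma^\pm(a)$ has $\partial_1^\pm\Gamma^\pm(a)=\partial_2^\pm\Gamma^\pm(a)=a$ and its two other edges are identities) satisfying the usual transport, cancellation and degeneracy laws. A triple category with connections has, in addition, a set of $3$-cubes with three compatible category structures $+_1,+_2,+_3$ over the squares, pairwise satisfying interchange, and connections $\Gamma_1^\pm,\Gamma_2^\pm$ from squares to $3$-cubes, satisfying all the axioms of a cubical $\omega$-category with connections that involve only dimensions $\le 3$. Let $\mathbb D$, $\mathbb T$ be the categories of double and of triple categories with connections, with the structure-preserving maps as morphisms, and let $\mathrm{tr}:\mathbb T\to\mathbb D$ be the functor that forgets the $3$-cubes. A double (triple) groupoid with connections is a double (triple) category with connections all of whose category structures are groupoids. A $3$-shell in $\mathsf D$ is a family of squares $\alpha=(\alpha_1^-,\alpha_1^+,\alpha_2^-,\alpha_2^+,\alpha_3^-,\alpha_3^+)$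 with $\partial_i^\sigma(\alpha_j^\tau)=\partial_{j-1}^\tau(\alpha_i^\sigma)$ for $1\le i<j\le 3$ and $\sigma,\tau=\pm$. It is commutative if $$\begin{bmatrix}\Gamma^+(\partial_2^-\alpha_1^-) & \alpha_1^- & \Gamma^-(\partial_2^+\alpha_1^-)\\ \alpha_3^- & \alpha_2^+ & \varepsilon_2(\partial_2^+\alpha_2^+)\end{bmatrix}=\begin{bmatrix}\varepsilon_2(\partial_2^-\alpha_2^-) & \alpha_2^- & \alpha_3^+\\ \Gamma^+(\partial_2^-\alpha_1^+) & \alpha_1^+ & \Gamma^-(\partial_2^+\alpha_1^+)\end{bmatrix},$$ where rows are composed by $+_2$ and columns by $+_1$. **Proposition.** The functor $\mathrm{tr}:\mathbb T\to\mathbb D$ has a left adjoint $\mathrm{sk}:\mathbb D\to\mathbb T$. If $\mathsf D$ is a double groupoid with connections, then $\mathrm{sk}\,\mathsf D$ is a triple groupoid with connections which agrees with $\mathsf D$ in dimensions $\le 2$ (the unit $\mathsf D\to\mathrm{tr}(\mathrm{sk}\,\mathsf D)$ is an isomorphism) and whose $3$-cubes are the commutative $3$-shells in $\mathsf D$: under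 this identification, sending a $3$-cube to the family of its six faces is a bijection from the $3$-cubes of $\mathrm{sk}\,\mathsf D$ onto the commutative $3$-shells in $\mathsf D$. -/

import Mathlib

open CategoryTheory

universe u

/-- A (small, single-sorted) category structure `(A, O, ∂⁻, ∂⁺, +, ε)`: arrows `A`, objects `O`,
source `∂⁻ = d false`, target `∂⁺ = d true`, identities `ε = e`, and a partial composition `a + b`
(written in diagrammatic order), defined exactly when `∂⁺ a = ∂⁻ b`. -/
structure CatStr (A O : Type u) where
  d : Bool → A → O
  e : O → A
  comp : (a b : A) → d true a = d false b → A
  d_e : ∀ σ x, d σ (e x) = x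
  d_false_comp : ∀ a b h, d false (comp a b h) = d false a
  d_true_comp : ∀ a b h, d true (comp a b h) = d true b
  e_comp : ∀ a, comp (e (d false a)) a (d_e _ _) = a
  comp_e : ∀ a, comp a (e (d true a)) (d_e _ _).symm = a
  assoc : ∀ a b c (h : d true a = d false b) (h' : d true b = d false c),
    comp (comp a b h) c ((d_true_comp a b h).trans h') =
      comp a (comp b c h') (h.trans (d_false_comp b c h').symm)

namespace CatStr

/-- `(f, g)` is a functor: `f` on arrows, `g` on objects. (The composite on the right-hand side of
`map_comp` is always defined, by `map_d`.) -/
structure IsFunctor {A O A' O' : Type u} (C : CatStr A O) (D : CatStr A' O')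
    (f : A → A') (g : O → O') : Prop where
  map_d : ∀ τ a, D.d τ (f a) = g (C.d τ a)
  map_e : ∀ x, f (C.e x) = D.e (g x)
  map_comp : ∀ a b (h : C.d true a = C.d false b) (h' : D.d true (f a) = D.d false (f b)),
    f (C.comp a b h) = D.comp (f a) (f b) h'

/-- Every arrow has a two-sided inverse. -/
def IsGroupoid {A O : Type u} (C : CatStr A O) : Prop :=
  ∀ a, ∃ (b : A) (h : C.d true a = C.d false b) (h' : C.d true b = C.d false a),
    C.comp a b h = C.e (C.d false a) ∧ C.comp b a h' = C.e (C.d true a)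

/-- The interchange law: `(a +_Q b) +_P (c +_Q d) = (a +_P c) +_Q (b +_P d)` whenever both sides
are defined. -/
def Interchange {A O : Type u} (P Q : CatStr A O) : Prop :=
  ∀ (a b c d : A) (hab : Q.d true a = Q.d false b) (hcd : Q.d true c = Q.d false d)
    (hac : P.d true a = P.d false c) (hbd : P.d true b = P.d false d)
    (h : P.d true (Q.comp a b hab) = P.d false (Q.comp c d hcd))
    (h' : Q.d true (P.comp a c hac) = Q.d false (P.comp b d hbd)),
    P.comp (Q.comp a b hab) (Q.comp c d hcd) h = Q.comp (P.comp a c hac) (P.comp b d hbd) h'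

/-- The laws which involve a pair of connections `Γ⁻ = Γ false`, `Γ⁺ = Γ true` (both in direction
`j`) and the directions `j`, `j + 1` only. Here `C` is the category structure in direction `j` on
the `n`-cubes `A`, and `P`, `Q` are those in the directions `j`, `j + 1` on the `(n+1)`-cubes `B`.
(The composites in the transport and cancellation laws are always defined, by the face laws.) -/
structure IsConnectionPair {O A B : Type u} (C : CatStr A O) (P Q : CatStr B A)
    (Γ : Bool → A → B) : Prop where
  face_fst : ∀ σ a, P.d σ (Γ σ a) = a
  face_snd : ∀ σ a, Q.d σ (Γ σ a) = a
  coface_fst : ∀ σ a, P.d (!σ) (Γ σ a) = C.e (C.d (!σ) a)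
  coface_snd : ∀ σ a, Q.d (!σ) (Γ σ a) = C.e (C.d (!σ) a)
  degenerate : ∀ σ x, Γ σ (C.e x) = P.e (C.e x)
  /-- `Γ⁺(a + b)` is the composite of the array with rows `Γ⁺ a, ε_{j+1} a` and `ε_j a, Γ⁺ b`. -/
  transport_true : ∀ a b (h : C.d true a = C.d false b)
    (h₁ : Q.d true (Γ true a) = Q.d false (Q.e a))
    (h₂ : Q.d true (P.e a) = Q.d false (Γ true b))
    (h₃ : P.d true (Q.comp (Γ true a) (Q.e a) h₁) = P.d false (Q.comp (P.e a) (Γ true b) h₂)),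
    Γ true (C.comp a b h) =
      P.comp (Q.comp (Γ true a) (Q.e a) h₁) (Q.comp (P.e a) (Γ true b) h₂) h₃
  /-- `Γ⁻(a + b)` is the composite of the array with rows `Γ⁻ a, ε_j b` and `ε_{j+1} b, Γ⁻ b`. -/
  transport_false : ∀ a b (h : C.d true a = C.d false b)
    (h₁ : Q.d true (Γ false a) = Q.d false (P.e b))
    (h₂ : Q.d true (Q.e b) = Q.d false (Γ false b))
    (h₃ : P.d true (Q.comp (Γ false a) (P.e b) h₁) = P.d false (Q.comp (Q.e b) (Γ false b) h₂)),
    Γ false (C.comp a b h) =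
      P.comp (Q.comp (Γ false a) (P.e b) h₁) (Q.comp (Q.e b) (Γ false b) h₂) h₃
  cancel_fst : ∀ a (h : P.d true (Γ true a) = P.d false (Γ false a)),
    P.comp (Γ true a) (Γ false a) h = Q.e a
  cancel_snd : ∀ a (h : Q.d true (Γ true a) = Q.d false (Γ false a)),
    Q.comp (Γ true a) (Γ false a) h = P.e a

end CatStr

/-- An (edge symmetric) double category: points `K0`, edges `K1`, squares `K2`, the category of
edges, and the category structures `s1` (vertical) and `s2` (horizontal) on squares. -/
structure DoubleCat where
  K0 : Type u
  K1 : Type u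
  K2 : Type u
  edge : CatStr K1 K0
  s1 : CatStr K2 K1
  s2 : CatStr K2 K1
  d1_functor : ∀ σ, s2.IsFunctor edge (s1.d σ) (edge.d σ)
  d2_functor : ∀ σ, s1.IsFunctor edge (s2.d σ) (edge.d σ)
  e1_functor : edge.IsFunctor s2 s1.e edge.e
  e2_functor : edge.IsFunctor s1 s2.e edge.e
  interchange : s1.Interchange s2

/-- A double category with connections `Γ⁻ = Γ false`, `Γ⁺ = Γ true`. -/
structure DoubleCatConn extends DoubleCat.{u} where
  Γ : Bool → K1 → K2
  Γ_conn : edge.IsConnectionPair s1 s2 Γ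

/-- A triple category with connections: a double category with connections, together with a set `K3`
of 3-cubes, category structures `c1, c2, c3` on it in the three directions, and connections
`G1 = Γ₁^±`, `G2 = Γ₂^±` from squares to 3-cubes, subject to the cubical laws in dimension three. -/
structure TripleCatConn extends DoubleCatConn.{u} where
  K3 : Type u
  c1 : CatStr K3 K2
  c2 : CatStr K3 K2
  c3 : CatStr K3 K2
  d12_functor : ∀ σ, c2.IsFunctor s1 (c1.d σ) (s1.d σ)
  d13_functor : ∀ σ, c3.IsFunctor s2 (c1.d σ) (s1.d σ)
  d21_functor : ∀ σ, c1.IsFunctor s1 (c2.d σ) (s1.d σ)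
  d23_functor : ∀ σ, c3.IsFunctor s2 (c2.d σ) (s2.d σ)
  d31_functor : ∀ σ, c1.IsFunctor s1 (c3.d σ) (s2.d σ)
  d32_functor : ∀ σ, c2.IsFunctor s2 (c3.d σ) (s2.d σ)
  e12_functor : s1.IsFunctor c2 c1.e s1.e
  e13_functor : s2.IsFunctor c3 c1.e s1.e
  e21_functor : s1.IsFunctor c1 c2.e s1.e
  e23_functor : s2.IsFunctor c3 c2.e s2.e
  e31_functor : s1.IsFunctor c1 c3.e s2.e
  e32_functor : s2.IsFunctor c2 c3.e s2.e
  interchange12 : c1.Interchange c2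
  interchange13 : c1.Interchange c3
  interchange23 : c2.Interchange c3
  G1 : Bool → K2 → K3
  G2 : Bool → K2 → K3
  G1_conn : s1.IsConnectionPair c1 c2 G1
  G2_conn : s2.IsConnectionPair c2 c3 G2
  G1_functor : ∀ σ, s2.IsFunctor c3 (G1 σ) (Γ σ)
  G2_functor : ∀ σ, s1.IsFunctor c1 (G2 σ) (Γ σ)
  G1_Γ : ∀ σ a, G1 σ (Γ σ a) = G2 σ (Γ σ a)

/-- Morphisms of double categories with connections. -/
@[ext]
structure DoubleHom (K L : DoubleCatConn.{u}) where
  map0 : K.K0 → L.K0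
  map1 : K.K1 → L.K1
  map2 : K.K2 → L.K2
  edge_functor : K.edge.IsFunctor L.edge map1 map0
  s1_functor : K.s1.IsFunctor L.s1 map2 map1
  s2_functor : K.s2.IsFunctor L.s2 map2 map1
  map_Γ : ∀ σ a, map2 (K.Γ σ a) = L.Γ σ (map1 a)

/-- Morphisms of triple categories with connections. -/
@[ext]
structure TripleHom (K L : TripleCatConn.{u}) extends
    DoubleHom K.toDoubleCatConn L.toDoubleCatConn where
  map3 : K.K3 → L.K3
  c1_functor : K.c1.IsFunctor L.c1 map3 map2
  c2_functor : K.c2.IsFunctor L.c2 map3 map2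
  c3_functor : K.c3.IsFunctor L.c3 map3 map2
  map_G1 : ∀ σ u, map3 (K.G1 σ u) = L.G1 σ (map2 u)
  map_G2 : ∀ σ u, map3 (K.G2 σ u) = L.G2 σ (map2 u)

theorem CatStr.IsFunctor.id {A O : Type u} (C : CatStr A O) :
    C.IsFunctor C (fun a => a) (fun x => x) :=
  ⟨fun _ _ => rfl, fun _ => rfl, fun _ _ _ _ => rfl⟩

theorem CatStr.IsFunctor.trans {A O A' O' A'' O'' : Type u} {C : CatStr A O} {D : CatStr A' O'}
    {E : CatStr A'' O''} {f : A → A'} {g : O → O'} {f' : A' → A''} {g' : O' → O''}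
    (F : C.IsFunctor D f g) (F' : D.IsFunctor E f' g') :
    C.IsFunctor E (fun a => f' (f a)) (fun x => g' (g x)) where
  map_d τ a := by rw [F'.map_d, F.map_d]
  map_e x := by rw [F.map_e, F'.map_e]
  map_comp a b h h' := by
    have h₁ : D.d true (f a) = D.d false (f b) := by rw [F.map_d, F.map_d, h]
    rw [F.map_comp a b h h₁, F'.map_comp _ _ h₁ h']

/-- The identity morphism. -/
def DoubleHom.id (K : DoubleCatConn.{u}) : DoubleHom K K where
  map0 x := x
  map1 a := a
  map2 u := u
  edge_functor := .id _
  s1_functor := .id _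
  s2_functor := .id _
  map_Γ _ _ := rfl

/-- Composition of morphisms. -/
def DoubleHom.comp {K L M : DoubleCatConn.{u}} (f : DoubleHom K L) (g : DoubleHom L M) :
    DoubleHom K M where
  map0 x := g.map0 (f.map0 x)
  map1 a := g.map1 (f.map1 a)
  map2 u := g.map2 (f.map2 u)
  edge_functor := f.edge_functor.trans g.edge_functor
  s1_functor := f.s1_functor.trans g.s1_functor
  s2_functor := f.s2_functor.trans g.s2_functor
  map_Γ σ a := by rw [f.map_Γ, g.map_Γ]

/-- The identity morphism. -/
def TripleHom.id (K : TripleCatConn.{u}) : TripleHom K K where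
  toDoubleHom := DoubleHom.id K.toDoubleCatConn
  map3 x := x
  c1_functor := .id _
  c2_functor := .id _
  c3_functor := .id _
  map_G1 _ _ := rfl
  map_G2 _ _ := rfl

/-- Composition of morphisms. -/
def TripleHom.comp {K L M : TripleCatConn.{u}} (f : TripleHom K L) (g : TripleHom L M) :
    TripleHom K M where
  toDoubleHom := f.toDoubleHom.comp g.toDoubleHom
  map3 x := g.map3 (f.map3 x)
  c1_functor := f.c1_functor.trans g.c1_functor
  c2_functor := f.c2_functor.trans g.c2_functor
  c3_functor := f.c3_functor.trans g.c3_functor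
  map_G1 σ u := by rw [f.map_G1, g.map_G1]; rfl
  map_G2 σ u := by rw [f.map_G2, g.map_G2]; rfl

/-- The category `𝔻` of double categories with connections. -/
instance : Category DoubleCatConn.{u} where
  Hom := DoubleHom
  id := DoubleHom.id
  comp f g := f.comp g

/-- The category `𝕋` of triple categories with connections. -/
instance : Category TripleCatConn.{u} where
  Hom := TripleHom
  id := TripleHom.id
  comp f g := f.comp g

/-- The truncation functor `tr : 𝕋 → 𝔻`, which forgets the 3-dimensional structure. -/
def tr : TripleCatConn.{u} ⥤ DoubleCatConn.{u} where
  obj K := K.toDoubleCatConn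
  map f := TripleHom.toDoubleHom f

/-- A double groupoid with connections: all three category structures are groupoids. -/
def DoubleCatConn.IsDoubleGroupoid (D : DoubleCatConn.{u}) : Prop :=
  D.edge.IsGroupoid ∧ D.s1.IsGroupoid ∧ D.s2.IsGroupoid

/-- A triple groupoid with connections: all the category structures are groupoids. -/
def TripleCatConn.IsTripleGroupoid (T : TripleCatConn.{u}) : Prop :=
  T.toDoubleCatConn.IsDoubleGroupoid ∧ T.c1.IsGroupoid ∧ T.c2.IsGroupoid ∧ T.c3.IsGroupoid

/-- A cube (3-shell) in a double category: squares `fi σ = α_i^σ` such that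
`∂_i^σ (α_j^τ) = ∂_{j-1}^τ (α_i^σ)` for `i < j`. -/
@[ext]
structure Shell (K : DoubleCat.{u}) where
  f1 : Bool → K.K2
  f2 : Bool → K.K2
  f3 : Bool → K.K2
  h12 : ∀ σ τ, K.s1.d σ (f2 τ) = K.s1.d τ (f1 σ)
  h13 : ∀ σ τ, K.s1.d σ (f3 τ) = K.s2.d τ (f1 σ)
  h23 : ∀ σ τ, K.s2.d σ (f3 τ) = K.s2.d τ (f2 σ)

/-- The composite `[x y z]` of a row of three squares. -/
def DoubleCat.row (K : DoubleCat.{u}) (x y z : K.K2) (h : K.s2.d true x = K.s2.d false y)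
    (h' : K.s2.d true y = K.s2.d false z) : K.K2 :=
  K.s2.comp (K.s2.comp x y h) z ((K.s2.d_true_comp x y h).trans h')

/-- Two rows with matching horizontal edges can be composed vertically. -/
theorem DoubleCat.row_composable (K : DoubleCat.{u}) {x y z x' y' z' : K.K2}
    (h : K.s2.d true x = K.s2.d false y) (h' : K.s2.d true y = K.s2.d false z)
    (k : K.s2.d true x' = K.s2.d false y') (k' : K.s2.d true y' = K.s2.d false z')
    (hx : K.s1.d true x = K.s1.d false x') (hy : K.s1.d true y = K.s1.d false y')
    (hz : K.s1.d true z = K.s1.d false z') :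
    K.s1.d true (K.row x y z h h') = K.s1.d false (K.row x' y' z' k k') := by
  have key : ∀ (σ : Bool) (u v : K.K2) (e : K.s2.d true u = K.s2.d false v),
      K.edge.d true (K.s1.d σ u) = K.edge.d false (K.s1.d σ v) := fun σ u v e => by
    rw [(K.d1_functor σ).map_d, (K.d1_functor σ).map_d, e]
  unfold DoubleCat.row
  rw [(K.d1_functor true).map_comp _ _ _ (key _ _ _ ((K.s2.d_true_comp x y h).trans h')),
    (K.d1_functor false).map_comp _ _ _ (key _ _ _ ((K.s2.d_true_comp x' y' k).trans k'))]
  simp only [(K.d1_functor true).map_comp x y h (key _ _ _ h),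
    (K.d1_functor false).map_comp x' y' k (key _ _ _ k), hx, hy, hz]

namespace Shell

variable {D : DoubleCatConn.{u}}

/-- The composite of the odd faces: the array with rows `Γ⁺, α₁⁻, Γ⁻` and `α₃⁻, α₂⁺, ε₂`
(the connections and the identity being those of the edges which make the array composable). -/
def odd (α : Shell D.toDoubleCat) : D.K2 :=
  D.s1.comp
    (D.row (D.Γ true (D.s2.d false (α.f1 false))) (α.f1 false)
      (D.Γ false (D.s2.d true (α.f1 false)))
      (D.Γ_conn.face_snd true _) (D.Γ_conn.face_snd false _).symm)
    (D.row (α.f3 false) (α.f2 true) (D.s2.e (D.s2.d true (α.f2 true)))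
      (α.h23 true false) (D.s2.d_e _ _).symm)
    (D.row_composable _ _ _ _
      (by rw [D.Γ_conn.face_fst, α.h13])
      (α.h12 false true).symm
      (by
        have h1 := D.Γ_conn.coface_fst false (D.s2.d true (α.f1 false))
        simp only [Bool.not_false] at h1
        rw [h1, D.e2_functor.map_d, (D.d2_functor true).map_d, (D.d2_functor true).map_d,
          α.h12]))

/-- The composite of the even faces: the array with rows `ε₂, α₂⁻, α₃⁺` and `Γ⁺, α₁⁺, Γ⁻`
(the connections and the identity being those of the edges which make the array composable). -/
def even (α : Shell D.toDoubleCat) : D.K2 :=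
  D.s1.comp
    (D.row (D.s2.e (D.s2.d false (α.f2 false))) (α.f2 false) (α.f3 true)
      (D.s2.d_e _ _) (α.h23 false true).symm)
    (D.row (D.Γ true (D.s2.d false (α.f1 true))) (α.f1 true)
      (D.Γ false (D.s2.d true (α.f1 true)))
      (D.Γ_conn.face_snd true _) (D.Γ_conn.face_snd false _).symm)
    (D.row_composable _ _ _ _
      (by
        have h1 := D.Γ_conn.coface_fst true (D.s2.d false (α.f1 true))
        simp only [Bool.not_true] at h1
        rw [h1, D.e2_functor.map_d, (D.d2_functor false).map_d, (D.d2_functor false).map_d,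
          α.h12])
      (α.h12 true false)
      (by rw [D.Γ_conn.face_fst, α.h13]))

/-- A 3-shell is commutative if its odd and its even faces have the same composite. -/
def IsCommutative (α : Shell D.toDoubleCat) : Prop :=
  α.odd = α.even

end Shell

/-! The left adjoint is built syntactically. A 3-cube of `D.free` is a formal composite (`Term`) of
degenerate cubes and connections on squares of `D`, and two formal composites are identified when
they have the same value in every triple category under `D`. The axioms then hold in the quotient
because they hold for the values (`FreeCube.ext`), and dimensions at most 2 are left untouched, so
the unit is an identity. Terms are indexed by their shells. This is possible because the shells of
`D` themselves form a triple category `D.cosk`, in which the boundary of each operation can be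
computed.

The identification of the 3-cubes rests on folding. Composing a square with connections along its
two vertical edges turns those edges into identities (`fold`). Applied to a 3-cube first in
directions 2, 3 and then in directions 1, 2, this leaves a cube whose faces in directions 2 and 3
are identities, and whose two faces in direction 1 are exactly the odd and the even composite of the
shell (`odd_shell`, `even_shell`). A cube is called thin if this complete folding is an identity. A
thin cube has a commutative shell. Degenerate cubes and connections are thin, and thin cubes are
closed under the three compositions, because the folding of a composite is a composite of foldings
padded with identities (`fold_comp_fst`, `fold_comp_snd`, `fold_comp_transverse`). Hence every cube
of `D.free` is thin.

If `D` is a double groupoid, connections are invertible, so folding can be undone once the discarded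
faces are known (`fold_injective`, `exists_fold_eq`). A thin cube is then determined by its shell.
Conversely, the complete folding of a commutative shell, computed in `D.cosk`, is the shell of an
identity cube, and unfolding that cube twice in `D.free` gives a cube with the prescribed shell
(`exists_shell_eq`). Invertibility in `D.free` in all three directions follows by induction on
formal composites. -/

namespace CatStr

/-! ### Single-sorted categories: composition, functors and identities. -/

section Basic

variable {A O A' O' : Type u} (C : CatStr A O) {D : CatStr A' O'}

theorem comp_congr {a a' b b' : A} (ha : a = a') (hb : b = b') (h : C.d true a = C.d false b)
    (h' : C.d true a' = C.d false b') : C.comp a b h = C.comp a' b' h' := by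
  subst ha hb; rfl

/-- The composability proof depends on the factors, so replacing them has to produce a new one;
hence the existential form. -/
theorem exists_comp_of_eq {C : CatStr A O} {z a a' b b' : A} {h : C.d true a = C.d false b}
    (e : z = C.comp a b h) (ha : a = a') (hb : b = b') : ∃ h', z = C.comp a' b' h' := by
  subst ha hb
  exact ⟨h, e⟩

theorem e_injective {x y : O} (h : C.e x = C.e y) : x = y := by
  rw [← C.d_e true x, h, C.d_e]

theorem comp_e_eq {a : A} {x : O} (h : C.d true a = C.d false (C.e x)) :
    C.comp a (C.e x) h = a := by
  obtain rfl : C.d true a = x := h.trans (C.d_e _ _)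
  exact C.comp_e a

theorem e_comp_eq {a : A} {x : O} (h : C.d true (C.e x) = C.d false a) :
    C.comp (C.e x) a h = a := by
  obtain rfl : x = C.d false a := (C.d_e _ _).symm.trans h
  exact C.e_comp a

theorem assoc' {a b c : A} (h : C.d true a = C.d false b)
    (h' : C.d true (C.comp a b h) = C.d false c)
    (k : C.d true b = C.d false c) (k' : C.d true a = C.d false (C.comp b c k)) :
    C.comp (C.comp a b h) c h' = C.comp a (C.comp b c k) k' :=
  C.assoc a b c h k

theorem assoc₄ {a b c d : A} (hab : C.d true a = C.d false b) (hbc : C.d true b = C.d false c)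
    (hcd : C.d true c = C.d false d) (h₁ : C.d true (C.comp a b hab) = C.d false c)
    (h₂ : C.d true (C.comp (C.comp a b hab) c h₁) = C.d false d)
    (h₃ : C.d true (C.comp b c hbc) = C.d false d)
    (h₄ : C.d true a = C.d false (C.comp (C.comp b c hbc) d h₃)) :
    C.comp (C.comp (C.comp a b hab) c h₁) d h₂ = C.comp a (C.comp (C.comp b c hbc) d h₃) h₄ := by
  rw [← C.assoc' (by rwa [C.d_false_comp]) (by rwa [C.d_true_comp, C.d_true_comp]) h₃ h₄]
  exact C.comp_congr (C.assoc' hab h₁ hbc _) rfl _ _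

variable {C}

theorem IsFunctor.composable {f : A → A'} {g : O → O'} (F : C.IsFunctor D f g) {a b : A}
    (h : C.d true a = C.d false b) : D.d true (f a) = D.d false (f b) := by
  rw [F.map_d, F.map_d, h]

theorem IsFunctor.map_comp' {f : A → A'} {g : O → O'} (F : C.IsFunctor D f g) {a b : A}
    (h : C.d true a = C.d false b) : f (C.comp a b h) = D.comp (f a) (f b) (F.composable h) :=
  F.map_comp a b h _

/-- `x` is an identity. -/
def IsIdentity (C : CatStr A O) (x : A) : Prop := ∃ u, x = C.e u

theorem isIdentity_e (u : O) : C.IsIdentity (C.e u) := ⟨u, rfl⟩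

theorem IsIdentity.eq {x : A} (hx : C.IsIdentity x) (σ : Bool) : x = C.e (C.d σ x) := by
  obtain ⟨u, rfl⟩ := hx
  rw [C.d_e]

theorem IsIdentity.comp {x y : A} (hx : C.IsIdentity x) (hy : C.IsIdentity y)
    (h : C.d true x = C.d false y) : C.IsIdentity (C.comp x y h) := by
  obtain ⟨u, rfl⟩ := hx
  rwa [C.e_comp_eq]

/-- Identities of `P` are closed under a second composition `Q` for which `P.e` is a functor. -/
theorem IsIdentity.comp_of_functor {B M : Type u} {E : CatStr A O} {P : CatStr B A}
    {Q : CatStr B M} {g : O → M} (hE : E.IsFunctor Q P.e g)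
    (hg : Function.Injective g) {x y : B}
    (hx : P.IsIdentity x) (hy : P.IsIdentity y) (h : Q.d true x = Q.d false y) :
    P.IsIdentity (Q.comp x y h) := by
  obtain ⟨u, rfl⟩ := hx
  obtain ⟨v, rfl⟩ := hy
  have huv : E.d true u = E.d false v := hg (by rw [← hE.map_d, ← hE.map_d, h])
  exact ⟨E.comp u v huv, (hE.map_comp' huv).symm⟩

end Basic

/-! ### Invertible arrows. -/

section Invertible

variable {A O A' O' : Type u} {C : CatStr A O} {D : CatStr A' O'}

/-- `b` is a two-sided inverse of `a`. -/
structure IsInverse (C : CatStr A O) (a b : A) : Prop where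
  left : C.d true a = C.d false b
  right : C.d true b = C.d false a
  comp_left : C.comp a b left = C.e (C.d false a)
  comp_right : C.comp b a right = C.e (C.d true a)

/-- `a` has a two-sided inverse. -/
def IsInvertible (C : CatStr A O) (a : A) : Prop := ∃ b, C.IsInverse a b

theorem isGroupoid_iff : C.IsGroupoid ↔ ∀ a, C.IsInvertible a :=
  ⟨fun H a => let ⟨b, h, h', e, e'⟩ := H a; ⟨b, h, h', e, e'⟩,
    fun H a => let ⟨b, h, h', e, e'⟩ := H a; ⟨b, h, h', e, e'⟩⟩

theorem IsInverse.symm {a b : A} (h : C.IsInverse a b) : C.IsInverse b a :=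
  ⟨h.right, h.left, by rw [h.comp_right, h.left], by rw [h.comp_left, h.right]⟩

theorem isInverse_e (x : O) : C.IsInverse (C.e x) (C.e x) :=
  ⟨by simp [C.d_e], by simp [C.d_e], by rw [C.e_comp_eq, C.d_e], by rw [C.e_comp_eq, C.d_e]⟩

theorem IsInverse.map {f : A → A'} {g : O → O'} (F : C.IsFunctor D f g) {a b : A}
    (h : C.IsInverse a b) : D.IsInverse (f a) (f b) :=
  ⟨F.composable h.left, F.composable h.right,
    by rw [← F.map_comp' h.left, h.comp_left, F.map_e, F.map_d],
    by rw [← F.map_comp' h.right, h.comp_right, F.map_e, F.map_d]⟩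

theorem IsInverse.unique {a b b' : A} (h : C.IsInverse a b) (h' : C.IsInverse a b') : b = b' := by
  have e := C.assoc b a b' h.right h'.left
  simp only [h.comp_right, h'.comp_left] at e
  rwa [C.e_comp_eq, C.comp_e_eq, eq_comm] at e

theorem IsInvertible.comp_left_cancel {a x y : A} (ha : C.IsInvertible a)
    (h : C.d true a = C.d false x) (h' : C.d true a = C.d false y)
    (e : C.comp a x h = C.comp a y h') : x = y := by
  obtain ⟨b, hb⟩ := ha
  have key : ∀ z (hz : C.d true a = C.d false z),
      C.comp b (C.comp a z hz) (by rw [C.d_false_comp, hb.right]) = z := fun z hz => by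
    rw [← C.assoc b a z hb.right hz]
    simp only [hb.comp_right, C.e_comp_eq]
  rw [← key x h, ← key y h']
  exact C.comp_congr rfl e _ _

theorem IsInvertible.comp_right_cancel {a x y : A} (ha : C.IsInvertible a)
    (h : C.d true x = C.d false a) (h' : C.d true y = C.d false a)
    (e : C.comp x a h = C.comp y a h') : x = y := by
  obtain ⟨b, hb⟩ := ha
  have key : ∀ z (hz : C.d true z = C.d false a),
      C.comp (C.comp z a hz) b (by rw [C.d_true_comp, hb.left]) = z := fun z hz => by
    rw [C.assoc z a b hz hb.left]
    simp only [hb.comp_left, C.comp_e_eq]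
  rw [← key x h, ← key y h']
  exact C.comp_congr e rfl _ _

theorem IsInvertible.map {f : A → A'} {g : O → O'} (F : C.IsFunctor D f g) {a : A}
    (h : C.IsInvertible a) : D.IsInvertible (f a) :=
  let ⟨b, hb⟩ := h
  ⟨f b, hb.map F⟩

theorem isInvertible_e (x : O) : C.IsInvertible (C.e x) := ⟨_, isInverse_e x⟩

theorem IsInverse.comp {a b a' b' : A} (ha : C.IsInverse a a') (hb : C.IsInverse b b')
    (h : C.d true a = C.d false b) (h' : C.d true b' = C.d false a') :
    C.IsInverse (C.comp a b h) (C.comp b' a' h') := by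
  have key : ∀ {a b a' b' : A} (_ : C.IsInverse a a') (_ : C.IsInverse b b')
      (h : C.d true a = C.d false b) (h' : C.d true b' = C.d false a')
      (k : C.d true (C.comp a b h) = C.d false (C.comp b' a' h')),
      C.comp (C.comp a b h) (C.comp b' a' h') k = C.e (C.d false (C.comp a b h)) := by
    intro a b a' b' ha hb h h' k
    rw [C.assoc' h k (by rw [C.d_false_comp, hb.left])
      (by rw [C.d_false_comp, h])]
    simp only [← C.assoc b b' a' hb.left h', hb.comp_left, C.e_comp_eq, ha.comp_left,
      C.d_false_comp]
  have k₁ : C.d true (C.comp a b h) = C.d false (C.comp b' a' h') := by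
    rw [C.d_true_comp, C.d_false_comp, hb.left]
  have k₂ : C.d true (C.comp b' a' h') = C.d false (C.comp a b h) := by
    rw [C.d_true_comp, C.d_false_comp, ha.right]
  exact ⟨k₁, k₂, key ha hb h h' k₁, by rw [key hb.symm ha.symm h' h k₂, k₁]⟩

theorem IsInvertible.comp {a b : A} (ha : C.IsInvertible a) (hb : C.IsInvertible b)
    (h : C.d true a = C.d false b) : C.IsInvertible (C.comp a b h) := by
  obtain ⟨a', ha⟩ := ha
  obtain ⟨b', hb⟩ := hb
  exact ⟨_, ha.comp hb h (by rw [hb.right, ← ha.left, h])⟩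

theorem IsInvertible.of_comp_left {a b : A} (ha : C.IsInvertible a)
    (h : C.d true a = C.d false b) (hab : C.IsInvertible (C.comp a b h)) : C.IsInvertible b := by
  obtain ⟨a', ha⟩ := ha
  have h₁ : C.d true a' = C.d false (C.comp a b h) := by rw [C.d_false_comp, ha.right]
  have h₂ := IsInvertible.comp ⟨a, ha.symm⟩ hab h₁
  have e := C.assoc a' a b ha.right h
  simp only [ha.comp_right, C.e_comp_eq] at e
  rwa [← e] at h₂

/-- An arrow with a right inverse which itself has a right inverse is invertible. -/
theorem isInvertible_of_right_inverses {a b c : A} (h : C.d true a = C.d false b)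
    (h' : C.d true b = C.d false c) (e : C.comp a b h = C.e (C.d false a))
    (e' : C.comp b c h' = C.e (C.d false b)) : C.IsInvertible a := by
  have hac : a = c := by
    have k := C.assoc a b c h h'
    simp only [e, e'] at k
    rwa [C.e_comp_eq, C.comp_e_eq, eq_comm] at k
  subst hac
  exact ⟨b, h, h', e, by rw [e', h]⟩

end Invertible

/-! ### Two compositions related by interchange. -/

section Interchange

variable {A O N N' : Type u} {P Q : CatStr A O} {E : CatStr O N}

/-- Composites of composable squares are composable. -/
theorem composable_comp {g : Bool → O → N} (F : ∀ σ, Q.IsFunctor E (P.d σ) (g σ)) {a b c d : A}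
    (hab : Q.d true a = Q.d false b) (hcd : Q.d true c = Q.d false d)
    (hac : P.d true a = P.d false c) (hbd : P.d true b = P.d false d) :
    P.d true (Q.comp a b hab) = P.d false (Q.comp c d hcd) := by
  rw [(F true).map_comp', (F false).map_comp']
  exact E.comp_congr hac hbd _ _

/-- The interchange law, read from columns to rows. -/
theorem Interchange.comp_of_eq {g : Bool → O → N} (I : P.Interchange Q)
    (F : ∀ σ, Q.IsFunctor E (P.d σ) (g σ)) {a b c d x y : A} {hac : P.d true a = P.d false c}
    {hbd : P.d true b = P.d false d} (hx : x = P.comp a c hac) (hy : y = P.comp b d hbd)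
    (hab : Q.d true a = Q.d false b) (hcd : Q.d true c = Q.d false d)
    (h' : Q.d true x = Q.d false y) :
    Q.comp x y h' = P.comp (Q.comp a b hab) (Q.comp c d hcd)
      (composable_comp F hab hcd hac hbd) := by
  subst hx hy
  exact (I a b c d hab hcd hac hbd _ h').symm

/-- Inverses for `P` are compatible with a second composition `Q`. -/
theorem IsInvertible.comp_transverse {E' : CatStr O N'} {g : Bool → O → N}
    {g' : Bool → O → N'} {k : N → O} (I : P.Interchange Q) (F : ∀ σ, Q.IsFunctor E (P.d σ) (g σ))
    (F' : ∀ σ, P.IsFunctor E' (Q.d σ) (g' σ)) (hE : E.IsFunctor Q P.e k) {a b : A}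
    (ha : P.IsInvertible a) (hb : P.IsInvertible b) (h : Q.d true a = Q.d false b) :
    P.IsInvertible (Q.comp a b h) := by
  have half : ∀ {a b a' b' : A} (_ : P.IsInverse a a') (_ : P.IsInverse b b')
      (h : Q.d true a = Q.d false b) (h' : Q.d true a' = Q.d false b')
      (l : P.d true (Q.comp a b h) = P.d false (Q.comp a' b' h')),
      P.comp (Q.comp a b h) (Q.comp a' b' h') l = P.e (P.d false (Q.comp a b h)) := by
    intro a b a' b' ha hb h h' l
    rw [I _ _ _ _ h h' ha.left hb.left l (composable_comp F' ha.left hb.left h h')]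
    simp only [ha.comp_left, hb.comp_left]
    rw [(F false).map_comp' h, hE.map_comp']
  obtain ⟨a', ha⟩ := ha
  obtain ⟨b', hb⟩ := hb
  -- The faces of the two inverses are both inverse to the common face of `a` and `b`, so they agree
  -- by uniqueness of inverses.
  have h' : Q.d true a' = Q.d false b' :=
    (ha.map (F' true)).unique (by rw [h]; exact hb.map (F' false))
  have l₁ := composable_comp F h h' ha.left hb.left
  have l₂ := composable_comp F h' h ha.right hb.right
  exact ⟨Q.comp a' b' h', l₁, l₂, half ha hb h h' l₁, by rw [half ha.symm hb.symm h' h l₂, l₁]⟩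

end Interchange

end CatStr

/-! ### Folding of squares. -/

namespace DoubleCatConn

variable {K : DoubleCatConn.{u}}

open CatStr

theorem d_s2_e (σ : Bool) (a : K.K1) : K.s1.d σ (K.s2.e a) = K.edge.e (K.edge.d σ a) :=
  K.e2_functor.map_d σ a

theorem d_s1_e (σ : Bool) (a : K.K1) : K.s2.d σ (K.s1.e a) = K.edge.e (K.edge.d σ a) :=
  K.e1_functor.map_d σ a

theorem d_d (σ τ : Bool) (x : K.K2) :
    K.edge.d τ (K.s1.d σ x) = K.edge.d σ (K.s2.d τ x) :=
  (K.d1_functor σ).map_d τ x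

theorem e_e (p : K.K0) : K.s1.e (K.edge.e p) = K.s2.e (K.edge.e p) :=
  K.e1_functor.map_e p

theorem interchange_of_eq {a b c d x y : K.K2} {hac : K.s1.d true a = K.s1.d false c}
    {hbd : K.s1.d true b = K.s1.d false d} (hx : x = K.s1.comp a c hac)
    (hy : y = K.s1.comp b d hbd) (hab : K.s2.d true a = K.s2.d false b)
    (hcd : K.s2.d true c = K.s2.d false d) (h' : K.s2.d true x = K.s2.d false y) :
    K.s2.comp x y h' = K.s1.comp (K.s2.comp a b hab) (K.s2.comp c d hcd)
        (composable_comp K.d1_functor hab hcd hac hbd) :=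
  Interchange.comp_of_eq K.interchange K.d1_functor hx hy hab hcd h'

/-- The folding of a square, whose vertical edges are identities. -/
def fold (x : K.K2) : K.K2 :=
  K.row (K.Γ true (K.s2.d false x)) x (K.Γ false (K.s2.d true x))
    (K.Γ_conn.face_snd true _) (K.Γ_conn.face_snd false _).symm

theorem Γ_e (σ : Bool) (p : K.K0) : K.Γ σ (K.edge.e p) = K.s1.e (K.edge.e p) :=
  K.Γ_conn.degenerate σ p

theorem d_fst_Γ_true_false (a : K.K1) :
    K.s1.d false (K.Γ true a) = K.edge.e (K.edge.d false a) :=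
  K.Γ_conn.coface_fst true a

theorem d_fst_Γ_false_true (a : K.K1) :
    K.s1.d true (K.Γ false a) = K.edge.e (K.edge.d true a) :=
  K.Γ_conn.coface_fst false a

theorem d_snd_Γ_true_false (a : K.K1) :
    K.s2.d false (K.Γ true a) = K.edge.e (K.edge.d false a) :=
  K.Γ_conn.coface_snd true a

theorem d_snd_Γ_false_true (a : K.K1) :
    K.s2.d true (K.Γ false a) = K.edge.e (K.edge.d true a) :=
  K.Γ_conn.coface_snd false a

theorem d_fst_Γ (σ : Bool) (a : K.K1) : K.s1.d σ (K.Γ σ a) = a := K.Γ_conn.face_fst σ a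

theorem d_snd_Γ (σ : Bool) (a : K.K1) : K.s2.d σ (K.Γ σ a) = a := K.Γ_conn.face_snd σ a

theorem d_snd_false_fold (x : K.K2) :
    K.s2.d false (fold x) = K.edge.e (K.edge.d false (K.s2.d false x)) := by
  rw [fold, DoubleCat.row, K.s2.d_false_comp, K.s2.d_false_comp, d_snd_Γ_true_false]

theorem d_snd_true_fold (x : K.K2) :
    K.s2.d true (fold x) = K.edge.e (K.edge.d true (K.s2.d true x)) := by
  rw [fold, DoubleCat.row, K.s2.d_true_comp, d_snd_Γ_false_true]

theorem d_fst_false_fold (x : K.K2) : K.s1.d false (fold x) =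
    K.edge.comp (K.s1.d false x) (K.s2.d true x) (d_d _ _ _) := by
  rw [fold, DoubleCat.row, (K.d1_functor false).map_comp']
  refine K.edge.comp_congr ?_ (d_fst_Γ _ _) _ _
  rw [(K.d1_functor false).map_comp' (d_snd_Γ true _)]
  simp only [d_fst_Γ_true_false, K.edge.e_comp_eq]

theorem d_fst_true_fold (x : K.K2) : K.s1.d true (fold x) =
    K.edge.comp (K.s2.d false x) (K.s1.d true x) (d_d _ _ _).symm := by
  rw [fold, DoubleCat.row, (K.d1_functor true).map_comp']
  simp only [d_fst_Γ_false_true, K.edge.comp_e_eq]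
  rw [(K.d1_functor true).map_comp' (d_snd_Γ true _)]
  exact K.edge.comp_congr (d_fst_Γ _ _) rfl _ _

theorem comp_snd_Γ (a : K.K1) (h : K.s2.d true (K.Γ true a) = K.s2.d false (K.Γ false a)) :
    K.s2.comp (K.Γ true a) (K.Γ false a) h = K.s1.e a := K.Γ_conn.cancel_snd a h

theorem fold_s1_e (a : K.K1) : fold (K.s1.e a) = K.s1.e a := by
  simp only [fold, DoubleCat.row, d_s1_e, Γ_e, e_e, K.s2.comp_e_eq, K.s2.e_comp_eq]

theorem fold_s2_e (a : K.K1) : fold (K.s2.e a) = K.s1.e a := by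
  simp only [fold, DoubleCat.row, K.s2.d_e, K.s2.comp_e_eq, comp_snd_Γ]

theorem fold_Γ (σ : Bool) (a : K.K1) : fold (K.Γ σ a) = K.s1.e a := by
  cases σ
  · simp only [fold, DoubleCat.row, d_snd_Γ_false_true, Γ_e, d_snd_Γ, comp_snd_Γ, e_e,
      K.s2.comp_e_eq]
  · simp only [fold, DoubleCat.row, d_snd_Γ_true_false, Γ_e, d_snd_Γ, e_e,
      K.s2.e_comp_eq, comp_snd_Γ]

/-- The transport law with its redundant identity `ε₂ a` absorbed, so that the first row is a single
connection. -/
theorem Γ_true_comp {a b : K.K1} (h : K.edge.d true a = K.edge.d false b) :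
    ∃ h₁ h₂, K.Γ true (K.edge.comp a b h) =
      K.s1.comp (K.Γ true a) (K.s2.comp (K.s1.e a) (K.Γ true b) h₁) h₂ := by
  have h₀ : K.s2.d true (K.Γ true a) = K.s2.d false (K.s2.e a) := by rw [d_snd_Γ, K.s2.d_e]
  have h₁ : K.s2.d true (K.s1.e a) = K.s2.d false (K.Γ true b) := by
    rw [d_s1_e, d_snd_Γ_true_false, h]
  have h₂ : K.s1.d true (K.Γ true a) = K.s1.d false (K.s2.comp (K.s1.e a) (K.Γ true b) h₁) := by
    rw [(K.d1_functor false).map_comp' h₁]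
    simp only [d_fst_Γ, K.s1.d_e, d_fst_Γ_true_false, K.edge.comp_e_eq]
  refine ⟨h₁, h₂, (K.Γ_conn.transport_true a b h h₀ h₁ ?_).trans ?_⟩
  · simpa only [K.s2.comp_e_eq] using h₂
  · simp only [K.s2.comp_e_eq]

theorem Γ_false_comp {a b : K.K1} (h : K.edge.d true a = K.edge.d false b) :
    ∃ h₁ h₂, K.Γ false (K.edge.comp a b h) =
      K.s1.comp (K.s2.comp (K.Γ false a) (K.s1.e b) h₁) (K.Γ false b) h₂ := by
  have h₀ : K.s2.d true (K.s2.e b) = K.s2.d false (K.Γ false b) := by rw [d_snd_Γ, K.s2.d_e]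
  have h₁ : K.s2.d true (K.Γ false a) = K.s2.d false (K.s1.e b) := by
    rw [d_s1_e, d_snd_Γ_false_true, h]
  have h₂ : K.s1.d true (K.s2.comp (K.Γ false a) (K.s1.e b) h₁) = K.s1.d false (K.Γ false b) := by
    rw [(K.d1_functor true).map_comp' h₁]
    simp only [d_fst_Γ, K.s1.d_e, d_fst_Γ_false_true, K.edge.e_comp_eq]
  refine ⟨h₁, h₂, (K.Γ_conn.transport_false a b h h₁ h₀ ?_).trans ?_⟩
  · simpa only [K.s2.e_comp_eq] using h₂
  · simp only [K.s2.e_comp_eq]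

/-- Transport writes each of the two outer connections as a vertical composite: `Γ⁺` over `[ε₁, Γ⁺]`
on the left, `[Γ⁻, ε₁]` over `Γ⁻` on the right. Interchange then separates the array into a row
containing `x` and a row containing `y`, each a folding padded with one `ε₁`. -/
theorem fold_comp_fst {x y : K.K2} (h : K.s1.d true x = K.s1.d false y) :
    ∃ h₁ h₂ h₃, fold (K.s1.comp x y h) =
      K.s1.comp (K.s2.comp (fold x) (K.s1.e (K.s2.d true y)) h₁)
        (K.s2.comp (K.s1.e (K.s2.d false x)) (fold y) h₂) h₃ := by
  have hl := (K.d2_functor false).composable h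
  have hr := (K.d2_functor true).composable h
  obtain ⟨a₁, a₂, eΓt⟩ := Γ_true_comp hl
  obtain ⟨b₁, b₂, eΓf⟩ := Γ_false_comp hr
  rw [← (K.d2_functor false).map_comp' h] at eΓt
  rw [← (K.d2_functor true).map_comp' h] at eΓf
  have hly : K.s2.d true (K.s2.comp (K.s1.e (K.s2.d false x)) (K.Γ true (K.s2.d false y)) a₁) =
    K.s2.d false y := by rw [K.s2.d_true_comp, d_snd_Γ]
  have hrx : K.s2.d true x =
      K.s2.d false (K.s2.comp (K.Γ false (K.s2.d true x)) (K.s1.e (K.s2.d true y)) b₁) := by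
    rw [K.s2.d_false_comp, d_snd_Γ]
  have e₁ := interchange_of_eq eΓt rfl (d_snd_Γ true _) hly (d_snd_Γ true _)
  have e₂ := interchange_of_eq e₁ eΓf (by rwa [K.s2.d_true_comp])
    (by rw [K.s2.d_true_comp, d_snd_Γ]) (by rw [K.s2.d_true_comp, d_snd_Γ])
  have c₁ : K.s2.d true (fold x) = K.s2.d false (K.s1.e (K.s2.d true y)) := by
    rw [d_snd_true_fold, d_s1_e, hr]
  have c₂ : K.s2.d true (K.s1.e (K.s2.d false x)) = K.s2.d false (fold y) := by
    rw [d_snd_false_fold, d_s1_e, hl]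
  have r₁ := K.s2.assoc' (by rw [K.s2.d_true_comp, d_snd_Γ]) c₁ b₁ (by rwa [K.s2.d_true_comp])
  have r₂ := K.s2.assoc₄ a₁ (d_snd_Γ _ _) (by rw [d_snd_Γ]) hly
    (by rw [K.s2.d_true_comp, d_snd_Γ]) (by rw [K.s2.d_true_comp, d_snd_Γ]) c₂
  obtain ⟨c₃, e⟩ := exists_comp_of_eq e₂ r₁.symm r₂
  exact ⟨c₁, c₂, c₃, e⟩

/-- An identity `ε₂` is inserted between `x` and `y` and split as `Γ⁺` over `Γ⁻`. The other squares
are padded vertically by identities, so that the upper row contains the folding of `y` and the lower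
row that of `x`. -/
theorem fold_comp_snd {x y : K.K2} (h : K.s2.d true x = K.s2.d false y) :
    ∃ h₁ h₂ h₃, fold (K.s2.comp x y h) =
      K.s1.comp (K.s2.comp (K.s1.e (K.s1.d false x)) (fold y) h₁)
        (K.s2.comp (fold x) (K.s1.e (K.s1.d true y)) h₂) h₃ := by
  have eΓt := K.s1.e_comp (K.Γ true (K.s2.d false x))
  have ex := K.s1.e_comp x
  have ey := K.s1.comp_e y
  have eΓf := K.s1.comp_e (K.Γ false (K.s2.d true y))
  -- The seam: the degenerate square on the common edge is `Γ⁺` above `Γ⁻`; its upper half begins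
  -- the folding of `y`, its lower half ends that of `x`.
  have em := K.Γ_conn.cancel_fst (K.s2.d true x) (by rw [d_fst_Γ, d_fst_Γ])
  have e₁ := interchange_of_eq eΓt.symm ex.symm (by rw [d_s1_e, d_s1_e, d_d, d_d, d_snd_Γ])
    (d_snd_Γ _ _) (d_snd_Γ _ _)
  have e₂ := interchange_of_eq e₁ em.symm
    (by rw [K.s2.d_true_comp, d_s1_e, d_snd_Γ_true_false, d_d])
    (by rw [K.s2.d_true_comp, d_snd_Γ]) (by rw [K.s2.d_true_comp, K.s2.d_e])
  have e₃ := interchange_of_eq e₂ ey.symm (by rw [K.s2.d_true_comp, d_snd_Γ, h])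
    (by rw [K.s2.d_true_comp, d_s1_e, d_snd_Γ_false_true, d_d, h])
    (by rw [K.s2.d_true_comp, K.s2.d_e, h])
  have e₄ := interchange_of_eq e₃ eΓf.symm (by rw [K.s2.d_true_comp, d_snd_Γ])
    (by rw [K.s2.d_true_comp, d_s1_e, d_s1_e, d_d, d_d, d_snd_Γ])
    (by rw [K.s2.d_true_comp, d_snd_Γ])
  have c₁ : K.s2.d true (K.s1.e (K.s1.d false x)) = K.s2.d false (fold y) := by
    rw [d_snd_false_fold, d_s1_e, d_d, h]
  have c₂ : K.s2.d true (fold x) = K.s2.d false (K.s1.e (K.s1.d true y)) := by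
    rw [d_snd_true_fold, d_s1_e, d_d, h]
  obtain ⟨c₃, e⟩ := exists_comp_of_eq e₄ (a' := K.s2.comp (K.s1.e (K.s1.d false x)) (fold y) c₁)
    (b' := K.s2.comp (fold x) (K.s1.e (K.s1.d true y)) c₂)
    -- The square above the left-hand `Γ⁺` is `ε₁` of an identity edge, hence also an `ε₂`, and
    -- disappears from the row. The right end of the lower row is treated in the same way.
    (by
      simp only [d_fst_Γ_true_false, e_e, K.s2.e_comp_eq, h]
      exact K.s2.assoc₄ _ (d_snd_Γ _ _) (by rw [d_snd_Γ]) _ _ _ _)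
    (by
      simp only [d_fst_Γ_false_true, e_e, K.s2.comp_e_eq]
      rfl)
  refine ⟨c₁, c₂, c₃, Eq.trans ?_ e⟩
  simp only [K.s2.comp_e_eq, fold, DoubleCat.row, K.s2.d_true_comp, K.s2.d_false_comp]
  exact K.s2.comp_congr (K.s2.assoc' _ _ _ _).symm rfl _ _

/-- Folding is compatible with a third composition. -/
theorem fold_comp_transverse {R : CatStr K.K2 K.K1} {E E' : CatStr K.K1 K.K0}
    {f g : Bool → K.K1 → K.K0} {k : Bool → K.K0 → K.K1} (I : R.Interchange K.s2)
    (F : ∀ σ, R.IsFunctor E (K.s2.d σ) (f σ)) (G : ∀ σ, K.s2.IsFunctor E' (R.d σ) (g σ))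
    (H : ∀ σ, E.IsFunctor R (K.Γ σ) (k σ)) {x y : K.K2} (h : R.d true x = R.d false y) :
    ∃ h', fold (R.comp x y h) = R.comp (fold x) (fold y) h' := by
  have hl := (H true).map_comp' ((F false).composable h)
  have hr := (H false).map_comp' ((F true).composable h)
  rw [← (F false).map_comp' h] at hl
  rw [← (F true).map_comp' h] at hr
  have e := Interchange.comp_of_eq I G hl rfl (d_snd_Γ _ _) (d_snd_Γ _ _) (d_snd_Γ _ _)
  exact ⟨_, Interchange.comp_of_eq I G e hr
    (by rw [K.s2.d_true_comp, d_snd_Γ]) (by rw [K.s2.d_true_comp, d_snd_Γ])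
    (by rw [K.s2.d_true_comp, d_snd_Γ])⟩

/-- Besides genuine morphisms, this is applied to faces and degeneracies of a triple category in the
direction transverse to the folding. -/
theorem fold_map {L : DoubleCatConn.{u}} (F : DoubleHom K L) (x : K.K2) :
    F.map2 (fold x) = fold (F.map2 x) := by
  rw [fold, DoubleCat.row, F.s2_functor.map_comp']
  simp only [fold, DoubleCat.row, F.s2_functor.map_d, ← F.map_Γ]
  refine L.s2.comp_congr (F.s2_functor.map_comp' (d_snd_Γ _ _)) rfl _ _

/-! ### Invertibility of connections, and unfolding over a groupoid of edges. -/

section Invertible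

/-- The transpose of a double category, with the same connections. -/
def transpose (K : DoubleCatConn.{u}) : DoubleCatConn.{u} where
  K0 := K.K0
  K1 := K.K1
  K2 := K.K2
  edge := K.edge
  s1 := K.s2
  s2 := K.s1
  d1_functor := K.d2_functor
  d2_functor := K.d1_functor
  e1_functor := K.e2_functor
  e2_functor := K.e1_functor
  interchange a b c d h₁ h₂ h₃ h₄ h₅ h₆ := (K.interchange a c b d h₃ h₄ h₁ h₂ h₆ h₅).symm
  Γ := K.Γ
  Γ_conn :=
    { face_fst := K.Γ_conn.face_snd
      face_snd := K.Γ_conn.face_fst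
      coface_fst := K.Γ_conn.coface_snd
      coface_snd := K.Γ_conn.coface_fst
      degenerate := fun σ x => (K.Γ_conn.degenerate σ x).trans (e_e x)
      transport_true := fun a b h h₁ h₂ h₃ => by
        have k₁ : K.s2.d true (K.Γ true a) = K.s2.d false (K.s2.e a) := by rw [d_snd_Γ, K.s2.d_e]
        have k₂ : K.s2.d true (K.s1.e a) = K.s2.d false (K.Γ true b) := by
          rw [d_s1_e, d_snd_Γ_true_false, h]
        rw [interchange_of_eq rfl rfl k₁ k₂]
        exact K.Γ_conn.transport_true a b h _ _ _
      transport_false := fun a b h h₁ h₂ h₃ => by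
        have k₁ : K.s2.d true (K.Γ false a) = K.s2.d false (K.s1.e b) := by
          rw [d_s1_e, d_snd_Γ_false_true, h]
        have k₂ : K.s2.d true (K.s2.e b) = K.s2.d false (K.Γ false b) := by rw [d_snd_Γ, K.s2.d_e]
        rw [interchange_of_eq rfl rfl k₁ k₂]
        exact K.Γ_conn.transport_false a b h _ _ _
      cancel_fst := K.Γ_conn.cancel_snd
      cancel_snd := K.Γ_conn.cancel_fst }

/-- If `b` is inverse to `a`, transport expands the identity `Γ⁺(a + b)` and exhibits `[ε₁ a, Γ⁺ b]`
as a right inverse of `Γ⁺ a`. With the roles of `a` and `b` exchanged, the same argument gives this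
right inverse a right inverse of its own, namely `[ε₁ a, [ε₁ b, Γ⁺ a]]`. -/
theorem isInvertible_Γ_true_fst {a : K.K1} (ha : K.edge.IsInvertible a) :
    K.s1.IsInvertible (K.Γ true a) := by
  obtain ⟨b, hb⟩ := ha
  have key : ∀ {a b : K.K1} (_ : K.edge.IsInverse a b), ∃ h₁ h₂,
      K.s1.comp (K.Γ true a) (K.s2.comp (K.s1.e a) (K.Γ true b) h₁) h₂ =
        K.s1.e (K.s1.d false (K.Γ true a)) := by
    intro a b hb
    obtain ⟨h₁, h₂, e⟩ := Γ_true_comp hb.left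
    refine ⟨h₁, h₂, ?_⟩
    rw [← e, hb.comp_left, Γ_e, d_fst_Γ_true_false]
  obtain ⟨h₁, h₂, e⟩ := key hb
  obtain ⟨k₁, k₂, e'⟩ := key hb.symm
  have l₁ : K.s2.d true (K.s1.e a) =
      K.s2.d false (K.s2.comp (K.s1.e b) (K.Γ true a) k₁) := by
    rw [K.s2.d_false_comp, d_s1_e, d_s1_e, hb.left]
  have l₂ : K.s1.d true (K.s1.e a) = K.s1.d false (K.s1.e a) := by simp only [K.s1.d_e]
  refine isInvertible_of_right_inverses h₂ (composable_comp K.d1_functor h₁ l₁ l₂ k₂) e ?_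
  -- Interchange leaves `ε₁ a` composed with itself on the left, and on the right the identity
  -- already obtained from `b + a`.
  rw [K.interchange _ _ _ _ h₁ l₁ l₂ k₂ _ (composable_comp K.d2_functor l₂ k₂ h₁ l₁),
    (K.d1_functor false).map_comp' h₁]
  simp only [e', K.s1.e_comp_eq, d_fst_Γ_true_false, e_e, K.s2.comp_e_eq, K.s1.d_e,
    K.edge.comp_e_eq]

/-- For `Γ⁻`, the cancellation law makes `Γ⁺ a` followed by `Γ⁻ a` equal to `ε₂ a`, which is
invertible, and the invertible factor `Γ⁺ a` can be removed. -/
theorem isInvertible_Γ_fst {a : K.K1} (ha : K.edge.IsInvertible a) (σ : Bool) :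
    K.s1.IsInvertible (K.Γ σ a) := by
  cases σ
  · have h : K.s1.d true (K.Γ true a) = K.s1.d false (K.Γ false a) := by rw [d_fst_Γ, d_fst_Γ]
    refine IsInvertible.of_comp_left (isInvertible_Γ_true_fst ha) h ?_
    rw [K.Γ_conn.cancel_fst]
    exact ha.map K.e2_functor
  · exact isInvertible_Γ_true_fst ha

theorem isInvertible_Γ_snd {a : K.K1} (ha : K.edge.IsInvertible a) (σ : Bool) :
    K.s2.IsInvertible (K.Γ σ a) :=
  isInvertible_Γ_fst (K := K.transpose) ha σ

/-- Squares with the same vertical edges are folded by the same connections, and these are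
invertible, hence cancellable. -/
theorem fold_injective (hK : K.edge.IsGroupoid) {x y : K.K2}
    (h : ∀ σ, K.s2.d σ x = K.s2.d σ y) (e : fold x = fold y) : x = y := by
  rw [isGroupoid_iff] at hK
  simp only [fold, DoubleCat.row, h] at e
  have e₁ := IsInvertible.comp_right_cancel (isInvertible_Γ_snd (hK _) false) _ _ e
  exact IsInvertible.comp_left_cancel (isInvertible_Γ_snd (hK _) true) _ _ e₁

/-- The unfolding of `z` is its composite with the horizontal inverses of `Γ⁺ a` and `Γ⁻ b`. -/
theorem exists_fold_eq (hK : K.edge.IsGroupoid) {z : K.K2} {a b : K.K1}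
    (ha : K.s2.d false z = K.edge.e (K.edge.d false a))
    (hb : K.s2.d true z = K.edge.e (K.edge.d true b)) :
    ∃ x, fold x = z ∧ K.s2.d false x = a ∧ K.s2.d true x = b := by
  rw [isGroupoid_iff] at hK
  obtain ⟨p, hp⟩ := isInvertible_Γ_snd (hK a) true
  obtain ⟨q, hq⟩ := isInvertible_Γ_snd (hK b) false
  have h₁ : K.s2.d true p = K.s2.d false z := by rw [hp.right, d_snd_Γ_true_false, ha]
  have h₂ : K.s2.d true z = K.s2.d false q := by rw [← hq.left, d_snd_Γ_false_true, hb]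
  have h₃ : K.s2.d true (K.s2.comp p z h₁) = K.s2.d false q := by rwa [K.s2.d_true_comp]
  have fa : K.s2.d false (K.s2.comp (K.s2.comp p z h₁) q h₃) = a := by
    rw [K.s2.d_false_comp, K.s2.d_false_comp, ← hp.left, d_snd_Γ]
  have fb : K.s2.d true (K.s2.comp (K.s2.comp p z h₁) q h₃) = b := by
    rw [K.s2.d_true_comp, hq.right, d_snd_Γ]
  refine ⟨_, ?_, fa, fb⟩
  simp only [fold, DoubleCat.row, fa, fb]
  rw [K.s2.assoc' _ _ (by rw [fb, d_snd_Γ]) (by rw [K.s2.d_false_comp, fa, d_snd_Γ])]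
  have e₁ := K.s2.assoc' h₃ (c := K.Γ false b) (by rw [fb, d_snd_Γ]) hq.right
    (by rw [K.s2.d_true_comp, K.s2.d_false_comp, h₂])
  simp only [e₁, hq.comp_right, K.s2.comp_e_eq]
  rw [← K.s2.assoc' hp.left (by rw [K.s2.d_true_comp, h₁])]
  simp only [hp.comp_left, K.s2.e_comp_eq]

/-- Lifts a square along `F` once its folding is lifted: the lift `z` is unfolded along the
preimages of the vertical edges of `y`, and injectivity of folding in `L` identifies the image with
`y`. -/
theorem exists_map_eq_of_map_eq_fold {L : DoubleCatConn.{u}} (F : DoubleHom K L)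
    (hF : Function.Bijective F.map1) (hK : K.edge.IsGroupoid) (hL : L.edge.IsGroupoid)
    {y : L.K2} {z : K.K2} (e : F.map2 z = fold y) : ∃ x, F.map2 x = y := by
  obtain ⟨a, ha⟩ := hF.2 (L.s2.d false y)
  obtain ⟨b, hb⟩ := hF.2 (L.s2.d true y)
  obtain ⟨x, hx, hxa, hxb⟩ := exists_fold_eq hK (z := z) (a := a) (b := b)
    (hF.1 (by rw [← F.s2_functor.map_d, e, d_snd_false_fold, ← ha, F.edge_functor.map_d,
      F.edge_functor.map_e]))
    (hF.1 (by rw [← F.s2_functor.map_d, e, d_snd_true_fold, ← hb, F.edge_functor.map_d,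
      F.edge_functor.map_e]))
  refine ⟨x, fold_injective hL (fun σ => ?_) (by rw [← fold_map, hx, e])⟩
  rw [F.s2_functor.map_d]
  cases σ
  · rw [hxa, ha]
  · rw [hxb, hb]

end Invertible

end DoubleCatConn

/-! ### Thin 3-cubes in a triple category. -/

namespace TripleCatConn

open CatStr

variable (T : TripleCatConn.{u})

/-- The double category of edges, squares and 3-cubes in the directions 1 and 2. -/
abbrev dc1 : DoubleCatConn.{u} where
  K0 := T.K1
  K1 := T.K2
  K2 := T.K3
  edge := T.s1
  s1 := T.c1
  s2 := T.c2
  d1_functor := T.d12_functor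
  d2_functor := T.d21_functor
  e1_functor := T.e12_functor
  e2_functor := T.e21_functor
  interchange := T.interchange12
  Γ := T.G1
  Γ_conn := T.G1_conn

/-- The double category of edges, squares and 3-cubes in the directions 2 and 3. -/
abbrev dc2 : DoubleCatConn.{u} where
  K0 := T.K1
  K1 := T.K2
  K2 := T.K3
  edge := T.s2
  s1 := T.c2
  s2 := T.c3
  d1_functor := T.d23_functor
  d2_functor := T.d32_functor
  e1_functor := T.e23_functor
  e2_functor := T.e32_functor
  interchange := T.interchange23
  Γ := T.G2
  Γ_conn := T.G2_conn

/-- The faces in direction 1 form a morphism of double categories. -/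
def d1Hom (σ : Bool) : DoubleHom T.dc2 T.toDoubleCatConn where
  map0 := T.edge.d σ
  map1 := T.s1.d σ
  map2 := T.c1.d σ
  edge_functor := T.d1_functor σ
  s1_functor := T.d12_functor σ
  s2_functor := T.d13_functor σ
  map_Γ τ u := (T.G2_functor τ).map_d σ u

/-- The faces in direction 3 form a morphism of double categories. -/
def d3Hom (σ : Bool) : DoubleHom T.dc1 T.toDoubleCatConn where
  map0 := T.edge.d σ
  map1 := T.s2.d σ
  map2 := T.c3.d σ
  edge_functor := T.d2_functor σ
  s1_functor := T.d31_functor σ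
  s2_functor := T.d32_functor σ
  map_Γ τ u := (T.G1_functor τ).map_d σ u

/-- The degeneracies in direction 1 form a morphism of double categories. -/
def e1Hom : DoubleHom T.toDoubleCatConn T.dc2 where
  map0 := T.edge.e
  map1 := T.s1.e
  map2 := T.c1.e
  edge_functor := T.e1_functor
  s1_functor := T.e12_functor
  s2_functor := T.e13_functor
  map_Γ τ a := ((T.G2_functor τ).map_e a).symm

/-- The folding in directions 1 and 2. -/
def fold1 (x : T.K3) : T.K3 := DoubleCatConn.fold (K := T.dc1) x

/-- The folding in directions 2 and 3. -/
def fold2 (x : T.K3) : T.K3 := DoubleCatConn.fold (K := T.dc2) x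

variable {T}

theorem isIdentity_comp2 {x y : T.K3} (hx : T.c1.IsIdentity x) (hy : T.c1.IsIdentity y)
    (h : T.c2.d true x = T.c2.d false y) : T.c1.IsIdentity (T.c2.comp x y h) :=
  hx.comp_of_functor T.e12_functor (fun _ _ => T.s1.e_injective) hy h

theorem isIdentity_comp3 {x y : T.K3} (hx : T.c1.IsIdentity x) (hy : T.c1.IsIdentity y)
    (h : T.c3.d true x = T.c3.d false y) : T.c1.IsIdentity (T.c3.comp x y h) :=
  hx.comp_of_functor T.e13_functor (fun _ _ => T.s1.e_injective) hy h

/-- The folding of the composite is assembled from the two foldings and some `ε₁`; identities in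
direction 1 are closed under the other compositions because `ε₁` is functorial. The companions for
directions 2 and 3 rest on the same closure. -/
theorem isIdentity_fold1_comp1 {x y : T.K3} (hx : T.c1.IsIdentity (T.fold1 x))
    (hy : T.c1.IsIdentity (T.fold1 y)) (h : T.c1.d true x = T.c1.d false y) :
    T.c1.IsIdentity (T.fold1 (T.c1.comp x y h)) := by
  obtain ⟨h₁, h₂, h₃, e⟩ := DoubleCatConn.fold_comp_fst (K := T.dc1) h
  rw [fold1, e]
  exact (isIdentity_comp2 hx (isIdentity_e _) h₁).comp (isIdentity_comp2 (isIdentity_e _) hy h₂) h₃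

theorem isIdentity_fold1_comp2 {x y : T.K3} (hx : T.c1.IsIdentity (T.fold1 x))
    (hy : T.c1.IsIdentity (T.fold1 y)) (h : T.c2.d true x = T.c2.d false y) :
    T.c1.IsIdentity (T.fold1 (T.c2.comp x y h)) := by
  obtain ⟨h₁, h₂, h₃, e⟩ := DoubleCatConn.fold_comp_snd (K := T.dc1) h
  rw [fold1, e]
  exact (isIdentity_comp2 (isIdentity_e _) hy h₁).comp (isIdentity_comp2 hx (isIdentity_e _) h₂) h₃

theorem fold1_comp3 {x y : T.K3} (h : T.c3.d true x = T.c3.d false y) :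
    ∃ h', T.fold1 (T.c3.comp x y h) = T.c3.comp (T.fold1 x) (T.fold1 y) h' :=
  DoubleCatConn.fold_comp_transverse (K := T.dc1)
    (fun a b c d h₁ h₂ h₃ h₄ h₅ h₆ => (T.interchange23 a c b d h₃ h₄ h₁ h₂ h₆ h₅).symm)
    T.d23_functor T.d32_functor T.G1_functor h

theorem fold2_comp1 {x y : T.K3} (h : T.c1.d true x = T.c1.d false y) :
    ∃ h', T.fold2 (T.c1.comp x y h) = T.c1.comp (T.fold2 x) (T.fold2 y) h' :=
  DoubleCatConn.fold_comp_transverse (K := T.dc2) T.interchange13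
    T.d31_functor T.d13_functor T.G2_functor h

theorem isIdentity_fold1_comp3 {x y : T.K3} (hx : T.c1.IsIdentity (T.fold1 x))
    (hy : T.c1.IsIdentity (T.fold1 y)) (h : T.c3.d true x = T.c3.d false y) :
    T.c1.IsIdentity (T.fold1 (T.c3.comp x y h)) := by
  obtain ⟨h', e⟩ := fold1_comp3 h
  rw [e]
  exact isIdentity_comp3 hx hy h'

theorem isIdentity_fold1_e1 (u : T.K2) : T.c1.IsIdentity (T.fold1 (T.c1.e u)) :=
  ⟨u, DoubleCatConn.fold_s1_e (K := T.dc1) u⟩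

theorem isIdentity_fold1_e2 (u : T.K2) : T.c1.IsIdentity (T.fold1 (T.c2.e u)) :=
  ⟨u, DoubleCatConn.fold_s2_e (K := T.dc1) u⟩

theorem isIdentity_fold1_G1 (σ : Bool) (u : T.K2) : T.c1.IsIdentity (T.fold1 (T.G1 σ u)) :=
  ⟨u, DoubleCatConn.fold_Γ (K := T.dc1) σ u⟩

variable (T) in
/-- A 3-cube is thin if its complete folding is an identity. -/
def IsThin (x : T.K3) : Prop := T.c1.IsIdentity (T.fold1 (T.fold2 x))

/-- Direction 1 is transverse to `fold2`, so `fold2` preserves this composition. In directions 2 and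
3 the inner folding instead contributes extra `ε₂` factors, which `fold1` sends to identities. -/
theorem IsThin.comp1 {x y : T.K3} (hx : T.IsThin x) (hy : T.IsThin y)
    (h : T.c1.d true x = T.c1.d false y) : T.IsThin (T.c1.comp x y h) := by
  obtain ⟨h', e⟩ := fold2_comp1 h
  rw [IsThin, e]
  exact isIdentity_fold1_comp1 hx hy h'

theorem IsThin.comp2 {x y : T.K3} (hx : T.IsThin x) (hy : T.IsThin y)
    (h : T.c2.d true x = T.c2.d false y) : T.IsThin (T.c2.comp x y h) := by
  obtain ⟨h₁, h₂, h₃, e⟩ := DoubleCatConn.fold_comp_fst (K := T.dc2) h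
  rw [IsThin, fold2, e]
  exact isIdentity_fold1_comp2 (isIdentity_fold1_comp3 hx (isIdentity_fold1_e2 _) h₁)
    (isIdentity_fold1_comp3 (isIdentity_fold1_e2 _) hy h₂) h₃

theorem IsThin.comp3 {x y : T.K3} (hx : T.IsThin x) (hy : T.IsThin y)
    (h : T.c3.d true x = T.c3.d false y) : T.IsThin (T.c3.comp x y h) := by
  obtain ⟨h₁, h₂, h₃, e⟩ := DoubleCatConn.fold_comp_snd (K := T.dc2) h
  rw [IsThin, fold2, e]
  exact isIdentity_fold1_comp2 (isIdentity_fold1_comp3 (isIdentity_fold1_e2 _) hy h₁)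
    (isIdentity_fold1_comp3 hx (isIdentity_fold1_e2 _) h₂) h₃

theorem isThin_e1 (u : T.K2) : T.IsThin (T.c1.e u) := by
  have e : T.fold2 (T.c1.e u) = T.c1.e (DoubleCatConn.fold u) :=
    (DoubleCatConn.fold_map T.e1Hom u).symm
  rw [IsThin, e]
  exact isIdentity_fold1_e1 _

theorem isThin_e2 (u : T.K2) : T.IsThin (T.c2.e u) := by
  rw [IsThin, fold2, DoubleCatConn.fold_s1_e (K := T.dc2) u]
  exact isIdentity_fold1_e2 _

theorem isThin_e3 (u : T.K2) : T.IsThin (T.c3.e u) := by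
  rw [IsThin, fold2, DoubleCatConn.fold_s2_e (K := T.dc2) u]
  exact isIdentity_fold1_e2 _

theorem isThin_G2 (σ : Bool) (u : T.K2) : T.IsThin (T.G2 σ u) := by
  rw [IsThin, fold2, DoubleCatConn.fold_Γ (K := T.dc2) σ u]
  exact isIdentity_fold1_e2 _

theorem c3_e_s1_e (a : T.K1) : T.c3.e (T.s1.e a) = T.c1.e (T.s2.e a) :=
  (T.e13_functor.map_e a).symm

/-- For equal signs, `G1_Γ` turns the cube into a first connection. For opposite signs, `G1_Γ` turns
an outer connection of the folding into a second connection that cancels the given cube to an `ε₃`;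
what remains is `ε₃` of `Γ⁺ a` followed by `Γ⁻ a`, that is `ε₃ ε₁ a = ε₁ ε₂ a`. -/
theorem isIdentity_fold1_G2_Γ (σ τ : Bool) (a : T.K1) :
    T.c1.IsIdentity (T.fold1 (T.G2 σ (T.Γ τ a))) := by
  by_cases hστ : σ = τ
  · subst hστ
    rw [← T.G1_Γ]
    exact isIdentity_fold1_G1 _ _
  have key : ∀ (v : T.K2) (h : T.c2.d true (T.G2 true v) = T.c2.d false (T.G2 false v)),
      T.c2.comp (T.G2 true v) (T.G2 false v) h = T.c3.e v := T.G2_conn.cancel_fst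
  have fc : ∀ σ v, T.c2.d σ (T.G2 σ v) = v := T.G2_conn.face_fst
  have g1 : ∀ σ a, T.G1 σ (T.s2.e a) = T.c3.e (T.Γ σ a) := fun σ a => (T.G1_functor σ).map_e a
  have hΓ := T.Γ_conn.cancel_snd a (by rw [T.Γ_conn.face_snd, T.Γ_conn.face_snd])
  have fin : T.c1.IsIdentity (T.c3.e (T.s2.comp (T.Γ true a) (T.Γ false a)
      (by rw [T.Γ_conn.face_snd, T.Γ_conn.face_snd]))) := by
    rw [hΓ, c3_e_s1_e]
    exact isIdentity_e _
  rw [T.e32_functor.map_comp'] at fin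
  cases σ
  · obtain rfl : τ = true := by simpa using hστ
    have c : T.c2.d true (T.G2 false (T.Γ true a)) = T.s2.e (T.s2.d true (T.Γ true a)) :=
      T.G2_conn.coface_fst false _
    simp only [fold1, DoubleCatConn.fold, DoubleCat.row, fc, c, T.Γ_conn.face_snd, g1, T.G1_Γ, key]
    exact fin
  · obtain rfl : τ = false := by simpa using hστ
    have c : T.c2.d false (T.G2 true (T.Γ false a)) = T.s2.e (T.s2.d false (T.Γ false a)) :=
      T.G2_conn.coface_fst true _
    have e := T.c2.assoc (T.G1 true (T.s2.e a)) (T.G2 true (T.Γ false a)) (T.G2 false (T.Γ false a))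
      (by rw [T.G1_conn.face_snd, c, T.Γ_conn.face_snd]) (by rw [fc, fc])
    simp only [key, g1] at e
    simp only [fold1, DoubleCatConn.fold, DoubleCat.row, fc, c, T.Γ_conn.face_snd, g1, T.G1_Γ, e]
    exact fin

/-- Since the faces of `G1 σ u` in direction 3 are connections, `fold2` surrounds it with cubes `G2
(Γ _)`, so thinness reduces to the preceding lemma and closure in direction 3. -/
theorem isThin_G1 (σ : Bool) (u : T.K2) : T.IsThin (T.G1 σ u) := by
  have d : ∀ τ, T.c3.d τ (T.G1 σ u) = T.Γ σ (T.s2.d τ u) := fun τ => (T.G1_functor σ).map_d τ u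
  simp only [IsThin, fold2, DoubleCatConn.fold, DoubleCat.row, d]
  exact isIdentity_fold1_comp3 (isIdentity_fold1_comp3 (isIdentity_fold1_G2_Γ _ _ _)
    (isIdentity_fold1_G1 _ _) _) (isIdentity_fold1_G2_Γ _ _ _) _

variable (T) in
/-- The shell of a 3-cube. -/
@[simps]
def shell (x : T.K3) : Shell T.toDoubleCat where
  f1 σ := T.c1.d σ x
  f2 σ := T.c2.d σ x
  f3 σ := T.c3.d σ x
  h12 σ τ := ((T.d12_functor σ).map_d τ x).symm
  h13 σ τ := ((T.d13_functor σ).map_d τ x).symm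
  h23 σ τ := ((T.d23_functor σ).map_d τ x).symm

theorem d1_fold2 (σ : Bool) (x : T.K3) :
    T.c1.d σ (T.fold2 x) = DoubleCatConn.fold (T.c1.d σ x) :=
  DoubleCatConn.fold_map (T.d1Hom σ) x

theorem d3_fold1 (σ : Bool) (x : T.K3) :
    T.c3.d σ (T.fold1 x) = DoubleCatConn.fold (T.c3.d σ x) :=
  DoubleCatConn.fold_map (T.d3Hom σ) x

/-- The face `∂₁⁻` of `fold1 y` is `∂₁⁻ y` over `∂₂⁺ y`. For `y = fold2 x` these are the folding of
`α₁⁻` and the row `α₃⁻, α₂⁺`: the two rows of the odd array, up to a redundant identity. -/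
theorem odd_shell (x : T.K3) :
    Shell.odd (D := T.toDoubleCatConn) (T.shell x) = T.c1.d false (T.fold1 (T.fold2 x)) := by
  have e := DoubleCatConn.d_fst_false_fold (K := T.dc1) (T.fold2 x)
  have e' : T.c2.d true (T.fold2 x) = _ := DoubleCatConn.d_fst_true_fold (K := T.dc2) x
  rw [fold1, e]
  simp only [d1_fold2, e', Shell.odd, DoubleCat.row, T.s2.comp_e_eq]
  rfl

theorem even_shell (x : T.K3) :
    Shell.even (D := T.toDoubleCatConn) (T.shell x) = T.c1.d true (T.fold1 (T.fold2 x)) := by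
  have e := DoubleCatConn.d_fst_true_fold (K := T.dc1) (T.fold2 x)
  have e' : T.c2.d false (T.fold2 x) = _ := DoubleCatConn.d_fst_false_fold (K := T.dc2) x
  rw [fold1, e]
  simp only [d1_fold2, e', Shell.even, DoubleCat.row, T.s2.e_comp_eq]
  rfl

theorem IsThin.isCommutative_shell {x : T.K3} (hx : T.IsThin x) :
    Shell.IsCommutative (D := T.toDoubleCatConn) (T.shell x) := by
  obtain ⟨u, hu⟩ := hx
  rw [Shell.IsCommutative, odd_shell, even_shell, hu, T.c1.d_e, T.c1.d_e]

theorem isIdentity_d2_fold1 (σ : Bool) (x : T.K3) : T.s1.IsIdentity (T.c2.d σ (T.fold1 x)) := by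
  cases σ
  · exact ⟨_, DoubleCatConn.d_snd_false_fold (K := T.dc1) x⟩
  · exact ⟨_, DoubleCatConn.d_snd_true_fold (K := T.dc1) x⟩

/-- The inner folding already makes the faces in direction 3 equal to some `ε₂ a`, and the outer one
acts on them as the folding of squares, which turns `ε₂ a` into `ε₁ a`. -/
theorem isIdentity_d3_fold1_fold2 (σ : Bool) (x : T.K3) :
    T.s1.IsIdentity (T.c3.d σ (T.fold1 (T.fold2 x))) := by
  have e : ∃ a, T.c3.d σ (T.fold2 x) = T.s2.e a := by
    cases σ
    · exact ⟨_, DoubleCatConn.d_snd_false_fold (K := T.dc2) x⟩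
    · exact ⟨_, DoubleCatConn.d_snd_true_fold (K := T.dc2) x⟩
  obtain ⟨a, e⟩ := e
  exact ⟨a, by rw [d3_fold1, e, DoubleCatConn.fold_s2_e]⟩

/-- In a triple category over a double groupoid, thin 3-cubes are determined by their shells. -/
theorem IsThin.eq_of_shell_eq (h₁ : T.s1.IsGroupoid) (h₂ : T.s2.IsGroupoid) {x y : T.K3}
    (hx : T.IsThin x) (hy : T.IsThin y) (h : T.shell x = T.shell y) : x = y := by
  have f1 : ∀ σ, T.c1.d σ x = T.c1.d σ y := fun σ => congrArg (fun s => s.f1 σ) h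
  have f2 : ∀ σ, T.c2.d σ x = T.c2.d σ y := fun σ => congrArg (fun s => s.f2 σ) h
  have f3 : ∀ σ, T.c3.d σ x = T.c3.d σ y := fun σ => congrArg (fun s => s.f3 σ) h
  refine DoubleCatConn.fold_injective (K := T.dc2) h₂ f3 ?_
  refine DoubleCatConn.fold_injective (K := T.dc1) h₁ (fun σ => ?_) ?_
  -- Cancelling the outer folding requires the direction 2 faces of the inner one to agree; these
  -- are composites of faces in directions 2 and 3 of the original cubes.
  · cases σ
    · have e : ∀ x, T.c2.d false (DoubleCatConn.fold (K := T.dc2) x) = _ :=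
        DoubleCatConn.d_fst_false_fold (K := T.dc2)
      simp only [e, f2, f3]
    · have e : ∀ x, T.c2.d true (DoubleCatConn.fold (K := T.dc2) x) = _ :=
        DoubleCatConn.d_fst_true_fold (K := T.dc2)
      simp only [e, f2, f3]
  -- The complete folding of a thin cube is the identity on its own `∂₁⁻` face, which is the odd
  -- composite of the shell.
  · change T.fold1 (T.fold2 x) = T.fold1 (T.fold2 y)
    rw [hx.eq false, hy.eq false, ← odd_shell, ← odd_shell, h]

end TripleCatConn

namespace TripleHom

variable {S T : TripleCatConn.{u}} (F : TripleHom S T)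

/-- The underlying morphism of the double categories in directions 1 and 2. -/
def hom1 : DoubleHom S.dc1 T.dc1 where
  map0 := F.map1
  map1 := F.map2
  map2 := F.map3
  edge_functor := F.s1_functor
  s1_functor := F.c1_functor
  s2_functor := F.c2_functor
  map_Γ := F.map_G1

/-- The underlying morphism of the double categories in directions 2 and 3. -/
def hom2 : DoubleHom S.dc2 T.dc2 where
  map0 := F.map1
  map1 := F.map2
  map2 := F.map3
  edge_functor := F.s2_functor
  s1_functor := F.c2_functor
  s2_functor := F.c3_functor
  map_Γ := F.map_G2

end TripleHom

/-! ### Shells as the 3-cubes of a triple category. -/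

namespace Shell

open CatStr DoubleCatConn

variable {D : DoubleCatConn.{u}}

theorem ext' {K : DoubleCat.{u}} {α β : Shell K} (h₁ : ∀ σ, α.f1 σ = β.f1 σ)
    (h₂ : ∀ σ, α.f2 σ = β.f2 σ) (h₃ : ∀ σ, α.f3 σ = β.f3 σ) : α = β :=
  Shell.ext (funext h₁) (funext h₂) (funext h₃)

/-- Composition of shells in direction 1. -/
@[simps]
def comp1 (α β : Shell D.toDoubleCat) (h : α.f1 true = β.f1 false) : Shell D.toDoubleCat where
  f1 σ := cond σ (β.f1 true) (α.f1 false)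
  f2 σ := D.s1.comp (α.f2 σ) (β.f2 σ) (by rw [α.h12, β.h12, h])
  f3 σ := D.s1.comp (α.f3 σ) (β.f3 σ) (by rw [α.h13, β.h13, h])
  h12 σ τ := by
    cases σ
    · simpa only [D.s1.d_false_comp, cond_true, cond_false] using α.h12 _ _
    · simpa only [D.s1.d_true_comp, cond_true, cond_false] using β.h12 _ _
  h13 σ τ := by
    cases σ
    · simpa only [D.s1.d_false_comp, cond_true, cond_false] using α.h13 _ _
    · simpa only [D.s1.d_true_comp, cond_true, cond_false] using β.h13 _ _
  h23 σ τ := by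
    rw [(D.d2_functor σ).map_comp', (D.d2_functor τ).map_comp']
    exact D.edge.comp_congr (α.h23 _ _) (β.h23 _ _) _ _

/-- Composition of shells in direction 2. -/
@[simps]
def comp2 (α β : Shell D.toDoubleCat) (h : α.f2 true = β.f2 false) : Shell D.toDoubleCat where
  f1 σ := D.s1.comp (α.f1 σ) (β.f1 σ) (by rw [← α.h12, ← β.h12, h])
  f2 σ := cond σ (β.f2 true) (α.f2 false)
  f3 σ := D.s2.comp (α.f3 σ) (β.f3 σ) (by rw [α.h23, β.h23, h])
  h12 σ τ := by
    cases τ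
    · simpa only [D.s1.d_false_comp, cond_true, cond_false] using α.h12 _ _
    · simpa only [D.s1.d_true_comp, cond_true, cond_false] using β.h12 _ _
  h13 σ τ := by
    rw [(D.d1_functor σ).map_comp', (D.d2_functor τ).map_comp']
    exact D.edge.comp_congr (α.h13 _ _) (β.h13 _ _) _ _
  h23 σ τ := by
    cases σ
    · simpa only [D.s2.d_false_comp, cond_true, cond_false] using α.h23 _ _
    · simpa only [D.s2.d_true_comp, cond_true, cond_false] using β.h23 _ _

/-- Composition of shells in direction 3. -/
@[simps]
def comp3 (α β : Shell D.toDoubleCat) (h : α.f3 true = β.f3 false) : Shell D.toDoubleCat where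
  f1 σ := D.s2.comp (α.f1 σ) (β.f1 σ) (by rw [← α.h13, ← β.h13, h])
  f2 σ := D.s2.comp (α.f2 σ) (β.f2 σ) (by rw [← α.h23, ← β.h23, h])
  f3 σ := cond σ (β.f3 true) (α.f3 false)
  h12 σ τ := by
    rw [(D.d1_functor σ).map_comp', (D.d1_functor τ).map_comp']
    exact D.edge.comp_congr (α.h12 _ _) (β.h12 _ _) _ _
  h13 σ τ := by
    cases τ
    · simpa only [D.s2.d_false_comp, cond_true, cond_false] using α.h13 _ _
    · simpa only [D.s2.d_true_comp, cond_true, cond_false] using β.h13 _ _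
  h23 σ τ := by
    cases τ
    · simpa only [D.s2.d_false_comp, cond_true, cond_false] using α.h23 _ _
    · simpa only [D.s2.d_true_comp, cond_true, cond_false] using β.h23 _ _

/-- The shell of the degenerate cube in direction 1. -/
@[simps]
def e1 (u : D.K2) : Shell D.toDoubleCat where
  f1 _ := u
  f2 σ := D.s1.e (D.s1.d σ u)
  f3 σ := D.s1.e (D.s2.d σ u)
  h12 σ τ := by rw [D.s1.d_e]
  h13 σ τ := by rw [D.s1.d_e]
  h23 σ τ := by rw [d_s1_e, d_s1_e, d_d]

/-- The shell of the degenerate cube in direction 2. -/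
@[simps]
def e2 (u : D.K2) : Shell D.toDoubleCat where
  f1 σ := D.s1.e (D.s1.d σ u)
  f2 _ := u
  f3 σ := D.s2.e (D.s2.d σ u)
  h12 σ τ := by rw [D.s1.d_e]
  h13 σ τ := by rw [d_s2_e, d_s1_e, d_d]
  h23 σ τ := by rw [D.s2.d_e]

/-- The shell of the degenerate cube in direction 3. -/
@[simps]
def e3 (u : D.K2) : Shell D.toDoubleCat where
  f1 σ := D.s2.e (D.s1.d σ u)
  f2 σ := D.s2.e (D.s2.d σ u)
  f3 _ := u
  h12 σ τ := by rw [d_s2_e, d_s2_e, d_d]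
  h13 σ τ := by rw [D.s2.d_e]
  h23 σ τ := by rw [D.s2.d_e]

/-- Merges the face and coface laws into the conditional form used for the shells of connections. -/
theorem d_fst_Γ_eq (σ τ : Bool) (a : D.K1) :
    D.s1.d τ (D.Γ σ a) = if τ = σ then a else D.edge.e (D.edge.d (!σ) a) := by
  by_cases h : τ = σ
  · rw [if_pos h, h, d_fst_Γ]
  · obtain rfl : τ = !σ := by cases σ <;> cases τ <;> simp_all
    rw [if_neg h]
    exact D.Γ_conn.coface_fst σ a

theorem d_snd_Γ_eq (σ τ : Bool) (a : D.K1) :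
    D.s2.d τ (D.Γ σ a) = if τ = σ then a else D.edge.e (D.edge.d (!σ) a) := by
  by_cases h : τ = σ
  · rw [if_pos h, h, d_snd_Γ]
  · obtain rfl : τ = !σ := by cases σ <;> cases τ <;> simp_all
    rw [if_neg h]
    exact D.Γ_conn.coface_snd σ a

/-- The shell of the first connections. -/
@[simps]
def G1 (σ : Bool) (u : D.K2) : Shell D.toDoubleCat where
  f1 τ := if τ = σ then u else D.s1.e (D.s1.d (!σ) u)
  f2 τ := if τ = σ then u else D.s1.e (D.s1.d (!σ) u)
  f3 τ := D.Γ σ (D.s2.d τ u)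
  h12 τ ρ := by
    cases σ <;> cases τ <;> cases ρ <;> simp [D.s1.d_e]
  h13 τ ρ := by
    rw [d_fst_Γ_eq]
    split_ifs
    · rfl
    · rw [d_s1_e, d_d]
  h23 τ ρ := by
    rw [d_snd_Γ_eq]
    split_ifs
    · rfl
    · rw [d_s1_e, d_d]

/-- The shell of the second connections. -/
@[simps]
def G2 (σ : Bool) (u : D.K2) : Shell D.toDoubleCat where
  f1 τ := D.Γ σ (D.s1.d τ u)
  f2 τ := if τ = σ then u else D.s2.e (D.s2.d (!σ) u)
  f3 τ := if τ = σ then u else D.s2.e (D.s2.d (!σ) u)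
  h12 τ ρ := by
    rw [d_fst_Γ_eq]
    split_ifs
    · rfl
    · rw [d_s2_e, d_d]
  h13 τ ρ := by
    rw [d_snd_Γ_eq]
    split_ifs
    · rfl
    · rw [d_s2_e, d_d]
  h23 τ ρ := by
    cases σ <;> cases τ <;> cases ρ <;> simp [D.s2.d_e]

/-- The category structure on shells in direction 1. -/
abbrev cat1 : CatStr (Shell D.toDoubleCat) D.K2 where
  d σ α := α.f1 σ
  e := e1
  comp := comp1
  d_e _ _ := e1_f1 _ _
  d_false_comp _ _ _ := rfl
  d_true_comp _ _ _ := rfl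
  e_comp α := by
    refine ext' ?_ ?_ ?_ <;> rintro (_ | _) <;>
      simp [← α.h12, ← α.h13, D.s1.e_comp]
  comp_e α := by
    refine ext' ?_ ?_ ?_ <;> rintro (_ | _) <;>
      simp [← α.h12, ← α.h13, D.s1.comp_e]
  assoc α β γ h h' := by
    refine ext' ?_ ?_ ?_ <;> rintro (_ | _) <;> simp <;> exact D.s1.assoc' _ _ _ _

/-- The category structure on shells in direction 2. -/
abbrev cat2 : CatStr (Shell D.toDoubleCat) D.K2 where
  d σ α := α.f2 σ
  e := e2
  comp := comp2
  d_e _ _ := e2_f2 _ _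
  d_false_comp _ _ _ := rfl
  d_true_comp _ _ _ := rfl
  e_comp α := by
    refine ext' ?_ ?_ ?_ <;> rintro (_ | _) <;>
      simp [α.h12, ← α.h23, D.s1.e_comp, D.s2.e_comp]
  comp_e α := by
    refine ext' ?_ ?_ ?_ <;> rintro (_ | _) <;>
      simp [α.h12, ← α.h23, D.s1.comp_e, D.s2.comp_e]
  assoc α β γ h h' := by
    refine ext' ?_ ?_ ?_ <;> rintro (_ | _) <;> simp <;>
      first | exact D.s1.assoc' _ _ _ _ | exact D.s2.assoc' _ _ _ _

/-- The category structure on shells in direction 3. -/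
abbrev cat3 : CatStr (Shell D.toDoubleCat) D.K2 where
  d σ α := α.f3 σ
  e := e3
  comp := comp3
  d_e _ _ := e3_f3 _ _
  d_false_comp _ _ _ := rfl
  d_true_comp _ _ _ := rfl
  e_comp α := by
    refine ext' ?_ ?_ ?_ <;> rintro (_ | _) <;>
      simp [α.h13, α.h23, D.s2.e_comp]
  comp_e α := by
    refine ext' ?_ ?_ ?_ <;> rintro (_ | _) <;>
      simp [α.h13, α.h23, D.s2.comp_e]
  assoc α β γ h h' := by
    refine ext' ?_ ?_ ?_ <;> rintro (_ | _) <;> simp <;> exact D.s2.assoc' _ _ _ _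

@[simp]
theorem cat1_d (σ : Bool) (α : Shell D.toDoubleCat) : cat1.d σ α = α.f1 σ := rfl

@[simp]
theorem cat1_e (u : D.K2) : cat1.e u = e1 u := rfl

@[simp]
theorem cat1_comp (α β : Shell D.toDoubleCat) (h : cat1.d true α = cat1.d false β) :
    cat1.comp α β h = comp1 α β (by simpa only [cat1_d] using h) := rfl

@[simp]
theorem cat2_d (σ : Bool) (α : Shell D.toDoubleCat) : cat2.d σ α = α.f2 σ := rfl

@[simp]
theorem cat2_e (u : D.K2) : cat2.e u = e2 u := rfl

@[simp]
theorem cat2_comp (α β : Shell D.toDoubleCat) (h : cat2.d true α = cat2.d false β) :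
    cat2.comp α β h = comp2 α β (by simpa only [cat2_d] using h) := rfl

@[simp]
theorem cat3_d (σ : Bool) (α : Shell D.toDoubleCat) : cat3.d σ α = α.f3 σ := rfl

@[simp]
theorem cat3_e (u : D.K2) : cat3.e u = e3 u := rfl

@[simp]
theorem cat3_comp (α β : Shell D.toDoubleCat) (h : cat3.d true α = cat3.d false β) :
    cat3.comp α β h = comp3 α β (by simpa only [cat3_d] using h) := rfl

end Shell

namespace Shell

open CatStr DoubleCatConn

variable {D : DoubleCatConn.{u}}

theorem e1_functor_cat2 : D.s1.IsFunctor cat2 (e1 (D := D)) D.s1.e where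
  map_d _ _ := rfl
  map_e a := by
    refine ext' ?_ ?_ ?_ <;> intro σ <;>
      simp [D.s1.d_e, d_s1_e, e_e]
  map_comp u v h h' := by
    refine ext' ?_ ?_ ?_ <;> intro σ
    · rfl
    · cases σ <;> simp [D.s1.d_false_comp, D.s1.d_true_comp]
    · simp [(D.d2_functor σ).map_comp' h, D.e1_functor.map_comp']

theorem e1_functor_cat3 : D.s2.IsFunctor cat3 (e1 (D := D)) D.s1.e where
  map_d _ _ := rfl
  map_e a := by
    refine ext' ?_ ?_ ?_ <;> intro σ <;>
      simp [D.s1.d_e, D.s2.d_e, d_s1_e, d_s2_e, e_e]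
  map_comp u v h h' := by
    refine ext' ?_ ?_ ?_ <;> intro σ
    · rfl
    · simp [(D.d1_functor σ).map_comp' h, D.e1_functor.map_comp']
    · cases σ <;> simp [D.s2.d_false_comp, D.s2.d_true_comp]

theorem e2_functor_cat1 : D.s1.IsFunctor cat1 (e2 (D := D)) D.s1.e where
  map_d _ _ := rfl
  map_e a := by
    refine ext' ?_ ?_ ?_ <;> intro σ <;>
      simp [D.s1.d_e, d_s1_e, e_e]
  map_comp u v h h' := by
    refine ext' ?_ ?_ ?_ <;> intro σ
    · cases σ <;> simp [D.s1.d_false_comp, D.s1.d_true_comp]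
    · rfl
    · simp [(D.d2_functor σ).map_comp' h, D.e2_functor.map_comp']

theorem e2_functor_cat3 : D.s2.IsFunctor cat3 (e2 (D := D)) D.s2.e where
  map_d _ _ := rfl
  map_e a := by
    refine ext' ?_ ?_ ?_ <;> intro σ <;>
      simp [D.s2.d_e, d_s2_e, e_e]
  map_comp u v h h' := by
    refine ext' ?_ ?_ ?_ <;> intro σ
    · simp [(D.d1_functor σ).map_comp' h, D.e1_functor.map_comp']
    · rfl
    · cases σ <;> simp [D.s2.d_false_comp, D.s2.d_true_comp]

theorem e3_functor_cat1 : D.s1.IsFunctor cat1 (e3 (D := D)) D.s2.e where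
  map_d _ _ := rfl
  map_e a := by
    refine ext' ?_ ?_ ?_ <;> intro σ <;>
      simp [D.s1.d_e, D.s2.d_e, d_s1_e, d_s2_e, e_e]
  map_comp u v h h' := by
    refine ext' ?_ ?_ ?_ <;> intro σ
    · cases σ <;> simp [D.s1.d_false_comp, D.s1.d_true_comp]
    · simp [(D.d2_functor σ).map_comp' h, D.e2_functor.map_comp']
    · rfl

theorem e3_functor_cat2 : D.s2.IsFunctor cat2 (e3 (D := D)) D.s2.e where
  map_d _ _ := rfl
  map_e a := by
    refine ext' ?_ ?_ ?_ <;> intro σ <;>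
      simp [D.s2.d_e, d_s2_e, e_e]
  map_comp u v h h' := by
    refine ext' ?_ ?_ ?_ <;> intro σ
    · simp [(D.d1_functor σ).map_comp' h, D.e2_functor.map_comp']
    · cases σ <;> simp [D.s2.d_false_comp, D.s2.d_true_comp]
    · rfl

theorem interchange12 : (cat1 (D := D)).Interchange cat2 := by
  intro a b c d hab hcd hac hbd h h'
  refine ext' ?_ ?_ ?_ <;> intro σ
  · cases σ <;> rfl
  · cases σ <;> rfl
  · exact D.interchange _ _ _ _ _ _ _ _ _ _

theorem interchange13 : (cat1 (D := D)).Interchange cat3 := by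
  intro a b c d hab hcd hac hbd h h'
  refine ext' ?_ ?_ ?_ <;> intro σ
  · cases σ <;> rfl
  · exact D.interchange _ _ _ _ _ _ _ _ _ _
  · cases σ <;> rfl

theorem interchange23 : (cat2 (D := D)).Interchange cat3 := by
  intro a b c d hab hcd hac hbd h h'
  refine ext' ?_ ?_ ?_ <;> intro σ
  · exact D.interchange _ _ _ _ _ _ _ _ _ _
  · cases σ <;> rfl
  · cases σ <;> rfl

theorem G1_connectionPair : D.s1.IsConnectionPair cat1 cat2 (G1 (D := D)) where
  face_fst σ u := by simp
  face_snd σ u := by simp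
  coface_fst σ u := by simp
  coface_snd σ u := by simp
  degenerate σ a := by
    refine ext' ?_ ?_ ?_ <;> intro τ <;> simp [D.s1.d_e, d_s1_e, Γ_e]
  transport_true a b h h₁ h₂ h₃ := by
    refine ext' ?_ ?_ ?_ <;> intro σ
    · cases σ <;> simp [D.s1.d_false_comp, D.s1.comp_e_eq]
    · cases σ <;> simp [D.s1.d_false_comp, D.s1.comp_e_eq]
    · simp only [G1_f3, (D.d2_functor σ).map_comp' h]
      exact D.Γ_conn.transport_true _ _ _ _ _ _
  transport_false a b h h₁ h₂ h₃ := by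
    refine ext' ?_ ?_ ?_ <;> intro σ
    · cases σ <;> simp [D.s1.d_true_comp, D.s1.e_comp_eq]
    · cases σ <;> simp [D.s1.d_true_comp, D.s1.e_comp_eq]
    · simp only [G1_f3, (D.d2_functor σ).map_comp' h]
      exact D.Γ_conn.transport_false _ _ _ _ _ _
  cancel_fst a h := by
    refine ext' ?_ ?_ ?_ <;> intro σ
    · cases σ <;> simp
    · cases σ <;> simp [D.s1.e_comp_eq, D.s1.comp_e_eq]
    · exact D.Γ_conn.cancel_fst _ _
  cancel_snd a h := by
    refine ext' ?_ ?_ ?_ <;> intro σ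
    · cases σ <;> simp [D.s1.e_comp_eq, D.s1.comp_e_eq]
    · cases σ <;> simp
    · exact D.Γ_conn.cancel_snd _ _

theorem G2_connectionPair : D.s2.IsConnectionPair cat2 cat3 (G2 (D := D)) where
  face_fst σ u := by simp
  face_snd σ u := by simp
  coface_fst σ u := by simp
  coface_snd σ u := by simp
  degenerate σ a := by
    refine ext' ?_ ?_ ?_ <;> intro τ <;> simp [D.s2.d_e, d_s2_e, Γ_e, e_e]
  transport_true a b h h₁ h₂ h₃ := by
    refine ext' ?_ ?_ ?_ <;> intro σ
    · simp only [G2_f1, (D.d1_functor σ).map_comp' h]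
      exact D.Γ_conn.transport_true _ _ _ _ _ _
    · cases σ <;> simp [D.s2.d_false_comp, D.s2.comp_e_eq]
    · cases σ <;> simp [D.s2.d_false_comp, D.s2.comp_e_eq]
  transport_false a b h h₁ h₂ h₃ := by
    refine ext' ?_ ?_ ?_ <;> intro σ
    · simp only [G2_f1, (D.d1_functor σ).map_comp' h]
      exact D.Γ_conn.transport_false _ _ _ _ _ _
    · cases σ <;> simp [D.s2.d_true_comp, D.s2.e_comp_eq]
    · cases σ <;> simp [D.s2.d_true_comp, D.s2.e_comp_eq]
  cancel_fst a h := by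
    refine ext' ?_ ?_ ?_ <;> intro σ
    · exact D.Γ_conn.cancel_fst _ _
    · cases σ <;> simp
    · cases σ <;> simp [D.s2.e_comp_eq, D.s2.comp_e_eq]
  cancel_snd a h := by
    refine ext' ?_ ?_ ?_ <;> intro σ
    · exact D.Γ_conn.cancel_snd _ _
    · cases σ <;> simp [D.s2.e_comp_eq, D.s2.comp_e_eq]
    · cases σ <;> simp

theorem G1_functor_cat3 (σ : Bool) : D.s2.IsFunctor cat3 (G1 (D := D) σ) (D.Γ σ) where
  map_d _ _ := rfl
  map_e a := by
    refine ext' ?_ ?_ ?_ <;> intro τ <;>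
      simp [D.s2.d_e, d_s2_e, e_e, d_fst_Γ_eq, d_snd_Γ_eq, apply_ite D.s2.e]
  map_comp u v h h' := by
    refine ext' ?_ ?_ ?_ <;> intro τ
    · by_cases hτ : τ = σ
      · simp [hτ]
      · simp [hτ, (D.d1_functor _).map_comp' h, D.e1_functor.map_comp']
    · by_cases hτ : τ = σ
      · simp [hτ]
      · simp [hτ, (D.d1_functor _).map_comp' h, D.e1_functor.map_comp']
    · cases τ <;> simp [D.s2.d_false_comp, D.s2.d_true_comp]

theorem G2_functor_cat1 (σ : Bool) : D.s1.IsFunctor cat1 (G2 (D := D) σ) (D.Γ σ) where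
  map_d _ _ := rfl
  map_e a := by
    refine ext' ?_ ?_ ?_ <;> intro τ <;>
      simp [D.s1.d_e, d_s1_e, e_e, d_fst_Γ_eq, d_snd_Γ_eq, apply_ite D.s1.e]
  map_comp u v h h' := by
    refine ext' ?_ ?_ ?_ <;> intro τ
    · cases τ <;> simp [D.s1.d_false_comp, D.s1.d_true_comp]
    · by_cases hτ : τ = σ
      · simp [hτ]
      · simp [hτ, (D.d2_functor _).map_comp' h, D.e2_functor.map_comp']
    · by_cases hτ : τ = σ
      · simp [hτ]
      · simp [hτ, (D.d2_functor _).map_comp' h, D.e2_functor.map_comp']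

theorem G1_Γ (σ : Bool) (a : D.K1) : G1 (D := D) σ (D.Γ σ a) = G2 σ (D.Γ σ a) := by
  refine ext' ?_ ?_ ?_ <;> intro τ <;> by_cases hτ : τ = σ <;>
    simp [hτ, d_fst_Γ_eq, d_snd_Γ_eq, Γ_e, e_e]

end Shell

/-- The triple category of shells in a double category with connections. -/
def DoubleCatConn.cosk (D : DoubleCatConn.{u}) : TripleCatConn.{u} where
  toDoubleCatConn := D
  K3 := Shell D.toDoubleCat
  c1 := Shell.cat1
  c2 := Shell.cat2
  c3 := Shell.cat3
  d12_functor σ := ⟨fun τ α => (α.h12 σ τ).symm, fun _ => rfl, fun _ _ _ _ => rfl⟩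
  d13_functor σ := ⟨fun τ α => (α.h13 σ τ).symm, fun _ => rfl, fun _ _ _ _ => rfl⟩
  d21_functor σ := ⟨fun τ α => α.h12 τ σ, fun _ => rfl, fun _ _ _ _ => rfl⟩
  d23_functor σ := ⟨fun τ α => (α.h23 σ τ).symm, fun _ => rfl, fun _ _ _ _ => rfl⟩
  d31_functor σ := ⟨fun τ α => α.h13 τ σ, fun _ => rfl, fun _ _ _ _ => rfl⟩
  d32_functor σ := ⟨fun τ α => α.h23 τ σ, fun _ => rfl, fun _ _ _ _ => rfl⟩
  e12_functor := Shell.e1_functor_cat2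
  e13_functor := Shell.e1_functor_cat3
  e21_functor := Shell.e2_functor_cat1
  e23_functor := Shell.e2_functor_cat3
  e31_functor := Shell.e3_functor_cat1
  e32_functor := Shell.e3_functor_cat2
  interchange12 := Shell.interchange12
  interchange13 := Shell.interchange13
  interchange23 := Shell.interchange23
  G1 := Shell.G1
  G2 := Shell.G2
  G1_conn := Shell.G1_connectionPair
  G2_conn := Shell.G2_connectionPair
  G1_functor := Shell.G1_functor_cat3
  G2_functor := Shell.G2_functor_cat1
  G1_Γ := Shell.G1_Γ

/-! ### Functoriality of shells. -/

namespace TripleCatConn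

/-- Taking shells is a morphism of triple categories, the identity in dimensions at most two. -/
def shellHom (T : TripleCatConn.{u}) : TripleHom T T.toDoubleCatConn.cosk where
  toDoubleHom := DoubleHom.id T.toDoubleCatConn
  map3 := T.shell
  c1_functor :=
    { map_d := fun _ _ => rfl
      map_e := fun u => Shell.ext' (fun σ => T.c1.d_e σ u) (fun σ => T.e12_functor.map_d σ u)
        (fun σ => T.e13_functor.map_d σ u)
      map_comp := fun a b h h' => Shell.ext'
        (fun σ => by cases σ; exacts [T.c1.d_false_comp _ _ _, T.c1.d_true_comp _ _ _])
        (fun σ => (T.d21_functor σ).map_comp' h) (fun σ => (T.d31_functor σ).map_comp' h) }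
  c2_functor :=
    { map_d := fun _ _ => rfl
      map_e := fun u => Shell.ext' (fun σ => T.e21_functor.map_d σ u) (fun σ => T.c2.d_e σ u)
        (fun σ => T.e23_functor.map_d σ u)
      map_comp := fun a b h h' => Shell.ext' (fun σ => (T.d12_functor σ).map_comp' h)
        (fun σ => by cases σ; exacts [T.c2.d_false_comp _ _ _, T.c2.d_true_comp _ _ _])
        (fun σ => (T.d32_functor σ).map_comp' h) }
  c3_functor :=
    { map_d := fun _ _ => rfl
      map_e := fun u => Shell.ext' (fun σ => T.e31_functor.map_d σ u)
        (fun σ => T.e32_functor.map_d σ u) (fun σ => T.c3.d_e σ u)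
      map_comp := fun a b h h' => Shell.ext' (fun σ => (T.d13_functor σ).map_comp' h)
        (fun σ => (T.d23_functor σ).map_comp' h)
        (fun σ => by cases σ; exacts [T.c3.d_false_comp _ _ _, T.c3.d_true_comp _ _ _]) }
  map_G1 σ u := Shell.ext' (fun τ => Shell.d_fst_Γ_eq (D := T.dc1) σ τ u)
    (fun τ => Shell.d_snd_Γ_eq (D := T.dc1) σ τ u) (fun τ => (T.G1_functor σ).map_d τ u)
  map_G2 σ u := Shell.ext' (fun τ => (T.G2_functor σ).map_d τ u)
    (fun τ => Shell.d_fst_Γ_eq (D := T.dc2) σ τ u) (fun τ => Shell.d_snd_Γ_eq (D := T.dc2) σ τ u)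

end TripleCatConn

namespace Shell

variable {D E : DoubleCatConn.{u}}

/-- The image of a shell under a morphism of double categories. -/
@[simps]
def map (f : DoubleHom D E) (α : Shell D.toDoubleCat) : Shell E.toDoubleCat where
  f1 σ := f.map2 (α.f1 σ)
  f2 σ := f.map2 (α.f2 σ)
  f3 σ := f.map2 (α.f3 σ)
  h12 σ τ := by rw [f.s1_functor.map_d, f.s1_functor.map_d, α.h12]
  h13 σ τ := by rw [f.s1_functor.map_d, f.s2_functor.map_d, α.h13]
  h23 σ τ := by rw [f.s2_functor.map_d, f.s2_functor.map_d, α.h23]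

theorem map_G1 (f : DoubleHom D E) (σ : Bool) (u : D.K2) :
    map f (G1 σ u) = G1 σ (f.map2 u) := by
  have e : ∀ τ, f.map2 ((G1 (D := D) σ u).f1 τ) = (G1 (D := E) σ (f.map2 u)).f1 τ := fun τ => by
    by_cases hτ : τ = σ <;> simp [hτ, f.s1_functor.map_e, f.s1_functor.map_d]
  exact ext' e e fun τ =>
    (f.map_Γ σ _).trans (congrArg (E.Γ σ) (f.s2_functor.map_d τ u).symm)

theorem map_G2 (f : DoubleHom D E) (σ : Bool) (u : D.K2) :
    map f (G2 σ u) = G2 σ (f.map2 u) := by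
  have e : ∀ τ, f.map2 ((G2 (D := D) σ u).f2 τ) = (G2 (D := E) σ (f.map2 u)).f2 τ := fun τ => by
    by_cases hτ : τ = σ <;> simp [hτ, f.s2_functor.map_e, f.s2_functor.map_d]
  exact ext' (fun τ => (f.map_Γ σ _).trans (congrArg (E.Γ σ) (f.s1_functor.map_d τ u).symm)) e e

/-- The morphism of triple categories of shells induced by a morphism of double categories. -/
def mapHom (f : DoubleHom D E) : TripleHom D.cosk E.cosk where
  toDoubleHom := f
  map3 := map f
  c1_functor :=
    { map_d := fun _ _ => rfl
      map_e := fun u => ext' (fun _ => rfl)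
        (fun σ => (f.s1_functor.map_e _).trans (congrArg E.s1.e (f.s1_functor.map_d σ u).symm))
        (fun σ => (f.s1_functor.map_e _).trans (congrArg E.s1.e (f.s2_functor.map_d σ u).symm))
      map_comp := fun a b h h' => ext' (fun σ => by cases σ <;> rfl)
        (fun σ => f.s1_functor.map_comp' _) (fun σ => f.s1_functor.map_comp' _) }
  c2_functor :=
    { map_d := fun _ _ => rfl
      map_e := fun u => ext'
        (fun σ => (f.s1_functor.map_e _).trans (congrArg E.s1.e (f.s1_functor.map_d σ u).symm))
        (fun _ => rfl)
        (fun σ => (f.s2_functor.map_e _).trans (congrArg E.s2.e (f.s2_functor.map_d σ u).symm))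
      map_comp := fun a b h h' => ext' (fun σ => f.s1_functor.map_comp' _)
        (fun σ => by cases σ <;> rfl) (fun σ => f.s2_functor.map_comp' _) }
  c3_functor :=
    { map_d := fun _ _ => rfl
      map_e := fun u => ext'
        (fun σ => (f.s2_functor.map_e _).trans (congrArg E.s2.e (f.s1_functor.map_d σ u).symm))
        (fun σ => (f.s2_functor.map_e _).trans (congrArg E.s2.e (f.s2_functor.map_d σ u).symm))
        (fun _ => rfl)
      map_comp := fun a b h h' => ext' (fun σ => f.s2_functor.map_comp' _)
        (fun σ => f.s2_functor.map_comp' _) (fun σ => by cases σ <;> rfl) }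
  map_G1 := map_G1 f
  map_G2 := map_G2 f

end Shell

/-! ### The free triple category on a double category. -/

namespace DoubleCatConn

open CatStr

variable (D : DoubleCatConn.{u})

/-- Formal composites of degenerate cubes and connections, indexed by their shells. -/
inductive Term : Shell D.toDoubleCat → Type u
  | e1 (u : D.K2) : Term (Shell.e1 u)
  | e2 (u : D.K2) : Term (Shell.e2 u)
  | e3 (u : D.K2) : Term (Shell.e3 u)
  | G1 (σ : Bool) (u : D.K2) : Term (Shell.G1 σ u)
  | G2 (σ : Bool) (u : D.K2) : Term (Shell.G2 σ u)
  | comp1 {α β : Shell D.toDoubleCat} (x : Term α) (y : Term β) (h : α.f1 true = β.f1 false) :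
      Term (Shell.comp1 α β h)
  | comp2 {α β : Shell D.toDoubleCat} (x : Term α) (y : Term β) (h : α.f2 true = β.f2 false) :
      Term (Shell.comp2 α β h)
  | comp3 {α β : Shell D.toDoubleCat} (x : Term α) (y : Term β) (h : α.f3 true = β.f3 false) :
      Term (Shell.comp3 α β h)

variable {D}

section Eval

variable {T : TripleCatConn.{u}} (f : DoubleHom D T.toDoubleCatConn)

/-- Composability of formal composites is decided in `D` by their shells; this carries it over to
their values in any `T`. -/
theorem composable_of_shell_eq {α β : Shell D.toDoubleCat} {x y : T.K3}
    (hx : T.shell x = α.map f) (hy : T.shell y = β.map f) :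
    (α.f1 true = β.f1 false → T.c1.d true x = T.c1.d false y) ∧
      (α.f2 true = β.f2 false → T.c2.d true x = T.c2.d false y) ∧
      (α.f3 true = β.f3 false → T.c3.d true x = T.c3.d false y) := by
  rw [Shell.ext_iff] at hx hy
  simp only [funext_iff, TripleCatConn.shell_f1, TripleCatConn.shell_f2, TripleCatConn.shell_f3,
    Shell.map_f1, Shell.map_f2, Shell.map_f3] at hx hy
  refine ⟨fun h => ?_, fun h => ?_, fun h => ?_⟩
  · rw [hx.1, hy.1, h]
  · rw [hx.2.1, hy.2.1, h]
  · rw [hx.2.2, hy.2.2, h]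

/-- The value of a formal composite in a triple category under `D`. -/
def Term.eval : ∀ {α : Shell D.toDoubleCat}, Term D α → {x : T.K3 // T.shell x = α.map f}
  | _, e1 u => ⟨T.c1.e (f.map2 u), (T.shellHom.c1_functor.map_e _).trans
      ((Shell.mapHom f).c1_functor.map_e u).symm⟩
  | _, e2 u => ⟨T.c2.e (f.map2 u), (T.shellHom.c2_functor.map_e _).trans
      ((Shell.mapHom f).c2_functor.map_e u).symm⟩
  | _, e3 u => ⟨T.c3.e (f.map2 u), (T.shellHom.c3_functor.map_e _).trans
      ((Shell.mapHom f).c3_functor.map_e u).symm⟩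
  | _, G1 σ u => ⟨T.G1 σ (f.map2 u), (T.shellHom.map_G1 _ _).trans
      ((Shell.mapHom f).map_G1 σ u).symm⟩
  | _, G2 σ u => ⟨T.G2 σ (f.map2 u), (T.shellHom.map_G2 _ _).trans
      ((Shell.mapHom f).map_G2 σ u).symm⟩
  | _, comp1 x y h =>
    have k := (composable_of_shell_eq f x.eval.2 y.eval.2).1 h
    ⟨T.c1.comp x.eval.1 y.eval.1 k, (T.shellHom.c1_functor.map_comp' k).trans
      ((CatStr.comp_congr _ x.eval.2 y.eval.2 _ _).trans
        ((Shell.mapHom f).c1_functor.map_comp' h).symm)⟩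
  | _, comp2 x y h =>
    have k := (composable_of_shell_eq f x.eval.2 y.eval.2).2.1 h
    ⟨T.c2.comp x.eval.1 y.eval.1 k, (T.shellHom.c2_functor.map_comp' k).trans
      ((CatStr.comp_congr _ x.eval.2 y.eval.2 _ _).trans
        ((Shell.mapHom f).c2_functor.map_comp' h).symm)⟩
  | _, comp3 x y h =>
    have k := (composable_of_shell_eq f x.eval.2 y.eval.2).2.2 h
    ⟨T.c3.comp x.eval.1 y.eval.1 k, (T.shellHom.c3_functor.map_comp' k).trans
      ((CatStr.comp_congr _ x.eval.2 y.eval.2 _ _).trans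
        ((Shell.mapHom f).c3_functor.map_comp' h).symm)⟩

end Eval

variable (D) in
/-- Formal composites are identified if they have the same value in every triple category
under `D`. -/
def termSetoid : Setoid (Σ α, Term D α) where
  r p q := ∀ (T : TripleCatConn.{u}) (f : DoubleHom D T.toDoubleCatConn),
    (p.2.eval f).1 = (q.2.eval f).1
  iseqv := ⟨fun _ _ _ => rfl, fun h T f => (h T f).symm, fun h h' T f => (h T f).trans (h' T f)⟩

variable (D) in
/-- The 3-cubes freely generated by `D`. -/
def FreeCube : Type u := Quotient (termSetoid D)

namespace FreeCube

/-- The class of a formal composite. -/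
def mk {α : Shell D.toDoubleCat} (x : Term D α) : FreeCube D :=
  Quotient.mk (termSetoid D) ⟨α, x⟩

/-- The value of a free 3-cube in a triple category under `D`. -/
def eval {T : TripleCatConn.{u}} (f : DoubleHom D T.toDoubleCatConn) (x : FreeCube D) : T.K3 :=
  Quotient.lift (s := termSetoid D) (fun p => (p.2.eval f).1) (fun _ _ h => h T f) x

theorem eval_mk {T : TripleCatConn.{u}} (f : DoubleHom D T.toDoubleCatConn)
    {α : Shell D.toDoubleCat} (x : Term D α) : (mk x).eval f = (x.eval f).1 := rfl

theorem exists_mk (x : FreeCube D) : ∃ (α : Shell D.toDoubleCat) (t : Term D α), mk t = x := by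
  obtain ⟨⟨α, t⟩, rfl⟩ := Quotient.exists_rep x
  exact ⟨α, t, rfl⟩

/-- Any equational law valid in all triple categories under `D` therefore holds for free cubes, with
no list of relations needed. -/
theorem ext {x y : FreeCube D} (h : ∀ (T : TripleCatConn.{u})
    (f : DoubleHom D T.toDoubleCatConn), x.eval f = y.eval f) : x = y := by
  obtain ⟨α, t, rfl⟩ := exists_mk x
  obtain ⟨β, s, rfl⟩ := exists_mk y
  exact Quotient.sound (s := termSetoid D) h

/-- The shell of a free 3-cube. -/
def shell (x : FreeCube D) : Shell D.toDoubleCat :=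
  x.eval (T := D.cosk) (DoubleHom.id D)

theorem shell_mk {α : Shell D.toDoubleCat} (x : Term D α) : (mk x).shell = α :=
  (x.eval (T := D.cosk) (DoubleHom.id D)).2

theorem shell_eval {T : TripleCatConn.{u}} (f : DoubleHom D T.toDoubleCatConn) (x : FreeCube D) :
    T.shell (x.eval f) = x.shell.map f := by
  obtain ⟨α, t, rfl⟩ := exists_mk x
  rw [shell_mk, eval_mk, (t.eval f).2]

theorem exists_mk_shell (x : FreeCube D) : ∃ t : Term D x.shell, mk t = x := by
  obtain ⟨α, t, rfl⟩ := exists_mk x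
  rw [shell_mk]
  exact ⟨t, rfl⟩

/-- A formal composite representing a free 3-cube. -/
noncomputable def rep (x : FreeCube D) : Term D x.shell := x.exists_mk_shell.choose

theorem mk_rep (x : FreeCube D) : mk x.rep = x := x.exists_mk_shell.choose_spec

theorem eval_rep {T : TripleCatConn.{u}} (f : DoubleHom D T.toDoubleCatConn) (x : FreeCube D) :
    (x.rep.eval f).1 = x.eval f := by
  rw [← eval_mk, mk_rep]

theorem d1_eval {T : TripleCatConn.{u}} (f : DoubleHom D T.toDoubleCatConn) (σ : Bool)
    (x : FreeCube D) : T.c1.d σ (x.eval f) = f.map2 (x.shell.f1 σ) :=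
  congrArg (fun s => s.f1 σ) (shell_eval f x)

theorem d2_eval {T : TripleCatConn.{u}} (f : DoubleHom D T.toDoubleCatConn) (σ : Bool)
    (x : FreeCube D) : T.c2.d σ (x.eval f) = f.map2 (x.shell.f2 σ) :=
  congrArg (fun s => s.f2 σ) (shell_eval f x)

theorem d3_eval {T : TripleCatConn.{u}} (f : DoubleHom D T.toDoubleCatConn) (σ : Bool)
    (x : FreeCube D) : T.c3.d σ (x.eval f) = f.map2 (x.shell.f3 σ) :=
  congrArg (fun s => s.f3 σ) (shell_eval f x)

theorem eval_comp1 {T : TripleCatConn.{u}} (f : DoubleHom D T.toDoubleCatConn) {x y : FreeCube D}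
    (h : x.shell.f1 true = y.shell.f1 false) : (mk (x.rep.comp1 y.rep h)).eval f =
      T.c1.comp (x.eval f) (y.eval f) (by rw [d1_eval, d1_eval, h]) :=
  T.c1.comp_congr (eval_rep f x) (eval_rep f y) _ _

theorem eval_comp2 {T : TripleCatConn.{u}} (f : DoubleHom D T.toDoubleCatConn) {x y : FreeCube D}
    (h : x.shell.f2 true = y.shell.f2 false) : (mk (x.rep.comp2 y.rep h)).eval f =
      T.c2.comp (x.eval f) (y.eval f) (by rw [d2_eval, d2_eval, h]) :=
  T.c2.comp_congr (eval_rep f x) (eval_rep f y) _ _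

theorem eval_comp3 {T : TripleCatConn.{u}} (f : DoubleHom D T.toDoubleCatConn) {x y : FreeCube D}
    (h : x.shell.f3 true = y.shell.f3 false) : (mk (x.rep.comp3 y.rep h)).eval f =
      T.c3.comp (x.eval f) (y.eval f) (by rw [d3_eval, d3_eval, h]) :=
  T.c3.comp_congr (eval_rep f x) (eval_rep f y) _ _

theorem eval_G1 {T : TripleCatConn.{u}} (f : DoubleHom D T.toDoubleCatConn) (σ : Bool) (u : D.K2) :
    (mk (Term.G1 σ u)).eval f = T.G1 σ (f.map2 u) := rfl

theorem eval_G2 {T : TripleCatConn.{u}} (f : DoubleHom D T.toDoubleCatConn) (σ : Bool) (u : D.K2) :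
    (mk (Term.G2 σ u)).eval f = T.G2 σ (f.map2 u) := rfl

/-- Free 3-cubes form a category in direction 1. -/
noncomputable def cat1 : CatStr (FreeCube D) D.K2 where
  d σ x := x.shell.f1 σ
  e u := mk (Term.e1 u)
  comp x y h := mk (x.rep.comp1 y.rep h)
  d_e σ u := by rw [shell_mk]; rfl
  d_false_comp x y h := by rw [shell_mk]; rfl
  d_true_comp x y h := by rw [shell_mk]; rfl
  e_comp x := ext fun T f => by
    rw [eval_comp1]
    exact T.c1.e_comp_eq _
  comp_e x := ext fun T f => by
    rw [eval_comp1]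
    exact T.c1.comp_e_eq _
  assoc x y z h h' := ext fun T f => by
    simp only [eval_comp1]
    exact T.c1.assoc' _ _ _ _

/-- Free 3-cubes form a category in direction 2. -/
noncomputable def cat2 : CatStr (FreeCube D) D.K2 where
  d σ x := x.shell.f2 σ
  e u := mk (Term.e2 u)
  comp x y h := mk (x.rep.comp2 y.rep h)
  d_e σ u := by rw [shell_mk]; rfl
  d_false_comp x y h := by rw [shell_mk]; rfl
  d_true_comp x y h := by rw [shell_mk]; rfl
  e_comp x := ext fun T f => by
    rw [eval_comp2]
    exact T.c2.e_comp_eq _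
  comp_e x := ext fun T f => by
    rw [eval_comp2]
    exact T.c2.comp_e_eq _
  assoc x y z h h' := ext fun T f => by
    simp only [eval_comp2]
    exact T.c2.assoc' _ _ _ _

/-- Free 3-cubes form a category in direction 3. -/
noncomputable def cat3 : CatStr (FreeCube D) D.K2 where
  d σ x := x.shell.f3 σ
  e u := mk (Term.e3 u)
  comp x y h := mk (x.rep.comp3 y.rep h)
  d_e σ u := by rw [shell_mk]; rfl
  d_false_comp x y h := by rw [shell_mk]; rfl
  d_true_comp x y h := by rw [shell_mk]; rfl
  e_comp x := ext fun T f => by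
    rw [eval_comp3]
    exact T.c3.e_comp_eq _
  comp_e x := ext fun T f => by
    rw [eval_comp3]
    exact T.c3.comp_e_eq _
  assoc x y z h h' := ext fun T f => by
    simp only [eval_comp3]
    exact T.c3.assoc' _ _ _ _

theorem eval_functor1 (T : TripleCatConn.{u}) (f : DoubleHom D T.toDoubleCatConn) :
    cat1.IsFunctor T.c1 (eval f) f.map2 where
  map_d σ x := d1_eval f σ x
  map_e _ := rfl
  map_comp _ _ h _ := eval_comp1 f h

theorem eval_functor2 (T : TripleCatConn.{u}) (f : DoubleHom D T.toDoubleCatConn) :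
    cat2.IsFunctor T.c2 (eval f) f.map2 where
  map_d σ x := d2_eval f σ x
  map_e _ := rfl
  map_comp _ _ h _ := eval_comp2 f h

theorem eval_functor3 (T : TripleCatConn.{u}) (f : DoubleHom D T.toDoubleCatConn) :
    cat3.IsFunctor T.c3 (eval f) f.map2 where
  map_d σ x := d3_eval f σ x
  map_e _ := rfl
  map_comp _ _ h _ := eval_comp3 f h

/-- Equations between free cubes are tested by evaluation. Face laws are equations between squares
of `D`; they are supplied separately, being read off the shells. -/
theorem isFunctor_of_eval {E : CatStr D.K2 D.K1} {C : CatStr (FreeCube D) D.K2}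
    {op : D.K2 → FreeCube D} {g : D.K1 → D.K2} {E' : ∀ T : TripleCatConn.{u}, CatStr T.K2 T.K1}
    {C' : ∀ T : TripleCatConn.{u}, CatStr T.K3 T.K2} {op' : ∀ T : TripleCatConn.{u}, T.K2 → T.K3}
    {g' : ∀ T : TripleCatConn.{u}, T.K1 → T.K2}
    (hC : ∀ T (f : DoubleHom D T.toDoubleCatConn), C.IsFunctor (C' T) (eval f) f.map2)
    (hE : ∀ T (f : DoubleHom D T.toDoubleCatConn), E.IsFunctor (E' T) f.map2 f.map1)
    (hT : ∀ T, (E' T).IsFunctor (C' T) (op' T) (g' T))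
    (hop : ∀ T (f : DoubleHom D T.toDoubleCatConn) u, (op u).eval f = op' T (f.map2 u))
    (hg : ∀ T (f : DoubleHom D T.toDoubleCatConn) a, f.map2 (g a) = g' T (f.map1 a))
    (hd : ∀ τ u, C.d τ (op u) = g (E.d τ u)) : E.IsFunctor C op g where
  map_d := hd
  map_e a := ext fun T f => by
    rw [hop, (hE T f).map_e, (hT T).map_e, (hC T f).map_e, hg]
  map_comp u v h h' := ext fun T f => by
    rw [hop, (hE T f).map_comp' h, (hT T).map_comp', (hC T f).map_comp' h']
    simp only [hop]

theorem interchange_of_eval {P Q : CatStr (FreeCube D) D.K2}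
    {P' Q' : ∀ T : TripleCatConn.{u}, CatStr T.K3 T.K2}
    (hP : ∀ T (f : DoubleHom D T.toDoubleCatConn), P.IsFunctor (P' T) (eval f) f.map2)
    (hQ : ∀ T (f : DoubleHom D T.toDoubleCatConn), Q.IsFunctor (Q' T) (eval f) f.map2)
    (hT : ∀ T, (P' T).Interchange (Q' T)) : P.Interchange Q := by
  intro a b c d hab hcd hac hbd h h'
  refine ext fun T f => ?_
  rw [(hP T f).map_comp' h, (hQ T f).map_comp' h']
  simp only [(hP T f).map_comp' hac, (hP T f).map_comp' hbd, (hQ T f).map_comp' hab,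
    (hQ T f).map_comp' hcd]
  exact hT T _ _ _ _ _ _ _ _ _ _

theorem isConnectionPair_of_eval {C : CatStr D.K2 D.K1} {P Q : CatStr (FreeCube D) D.K2}
    {G : Bool → D.K2 → FreeCube D} {C' : ∀ T : TripleCatConn.{u}, CatStr T.K2 T.K1}
    {P' Q' : ∀ T : TripleCatConn.{u}, CatStr T.K3 T.K2}
    {G' : ∀ T : TripleCatConn.{u}, Bool → T.K2 → T.K3}
    (hC : ∀ T (f : DoubleHom D T.toDoubleCatConn), C.IsFunctor (C' T) f.map2 f.map1)
    (hP : ∀ T (f : DoubleHom D T.toDoubleCatConn), P.IsFunctor (P' T) (eval f) f.map2)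
    (hQ : ∀ T (f : DoubleHom D T.toDoubleCatConn), Q.IsFunctor (Q' T) (eval f) f.map2)
    (hG : ∀ T (f : DoubleHom D T.toDoubleCatConn) σ u, (G σ u).eval f = G' T σ (f.map2 u))
    (hT : ∀ T, (C' T).IsConnectionPair (P' T) (Q' T) (G' T))
    (face_fst : ∀ σ u, P.d σ (G σ u) = u) (face_snd : ∀ σ u, Q.d σ (G σ u) = u)
    (coface_fst : ∀ σ u, P.d (!σ) (G σ u) = C.e (C.d (!σ) u))
    (coface_snd : ∀ σ u, Q.d (!σ) (G σ u) = C.e (C.d (!σ) u)) :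
    C.IsConnectionPair P Q G where
  face_fst := face_fst
  face_snd := face_snd
  coface_fst := coface_fst
  coface_snd := coface_snd
  degenerate σ a := ext fun T f => by
    rw [hG, (hC T f).map_e, (hP T f).map_e, (hC T f).map_e, (hT T).degenerate]
  transport_true a b h h₁ h₂ h₃ := ext fun T f => by
    rw [hG, (hC T f).map_comp' h, (hP T f).map_comp' h₃]
    simp only [(hQ T f).map_comp' h₁, (hQ T f).map_comp' h₂, hG, (hQ T f).map_e, (hP T f).map_e]
    exact (hT T).transport_true _ _ _ _ _ _
  transport_false a b h h₁ h₂ h₃ := ext fun T f => by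
    rw [hG, (hC T f).map_comp' h, (hP T f).map_comp' h₃]
    simp only [(hQ T f).map_comp' h₁, (hQ T f).map_comp' h₂, hG, (hQ T f).map_e, (hP T f).map_e]
    exact (hT T).transport_false _ _ _ _ _ _
  cancel_fst a h := ext fun T f => by
    rw [(hP T f).map_comp' h, (hQ T f).map_e]
    simp only [hG, (hT T).cancel_fst]
  cancel_snd a h := ext fun T f => by
    rw [(hQ T f).map_comp' h, (hP T f).map_e]
    simp only [hG, (hT T).cancel_snd]

end FreeCube

variable (D) in
/-- The triple category with connections freely generated by a double category with
connections. -/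
noncomputable def free : TripleCatConn.{u} where
  toDoubleCatConn := D
  K3 := FreeCube D
  c1 := FreeCube.cat1
  c2 := FreeCube.cat2
  c3 := FreeCube.cat3
  d12_functor σ := ⟨fun τ x => (x.shell.h12 σ τ).symm,
    fun u => congrArg (fun s => s.f1 σ) (FreeCube.shell_mk (Term.e2 u)),
    fun x y h _ => congrArg (fun s => s.f1 σ) (FreeCube.shell_mk (x.rep.comp2 y.rep h))⟩
  d13_functor σ := ⟨fun τ x => (x.shell.h13 σ τ).symm,
    fun u => congrArg (fun s => s.f1 σ) (FreeCube.shell_mk (Term.e3 u)),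
    fun x y h _ => congrArg (fun s => s.f1 σ) (FreeCube.shell_mk (x.rep.comp3 y.rep h))⟩
  d21_functor σ := ⟨fun τ x => (x.shell.h12 τ σ),
    fun u => congrArg (fun s => s.f2 σ) (FreeCube.shell_mk (Term.e1 u)),
    fun x y h _ => congrArg (fun s => s.f2 σ) (FreeCube.shell_mk (x.rep.comp1 y.rep h))⟩
  d23_functor σ := ⟨fun τ x => (x.shell.h23 σ τ).symm,
    fun u => congrArg (fun s => s.f2 σ) (FreeCube.shell_mk (Term.e3 u)),
    fun x y h _ => congrArg (fun s => s.f2 σ) (FreeCube.shell_mk (x.rep.comp3 y.rep h))⟩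
  d31_functor σ := ⟨fun τ x => (x.shell.h13 τ σ),
    fun u => congrArg (fun s => s.f3 σ) (FreeCube.shell_mk (Term.e1 u)),
    fun x y h _ => congrArg (fun s => s.f3 σ) (FreeCube.shell_mk (x.rep.comp1 y.rep h))⟩
  d32_functor σ := ⟨fun τ x => (x.shell.h23 τ σ),
    fun u => congrArg (fun s => s.f3 σ) (FreeCube.shell_mk (Term.e2 u)),
    fun x y h _ => congrArg (fun s => s.f3 σ) (FreeCube.shell_mk (x.rep.comp2 y.rep h))⟩
  e12_functor := FreeCube.isFunctor_of_eval FreeCube.eval_functor2 (fun _ f => f.s1_functor)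
    (fun T => T.e12_functor) (fun _ _ _ => rfl) (fun _ f => f.s1_functor.map_e)
    (fun τ u => congrArg (fun s => s.f2 τ) (FreeCube.shell_mk (Term.e1 u)))
  e13_functor := FreeCube.isFunctor_of_eval FreeCube.eval_functor3 (fun _ f => f.s2_functor)
    (fun T => T.e13_functor) (fun _ _ _ => rfl) (fun _ f => f.s1_functor.map_e)
    (fun τ u => congrArg (fun s => s.f3 τ) (FreeCube.shell_mk (Term.e1 u)))
  e21_functor := FreeCube.isFunctor_of_eval FreeCube.eval_functor1 (fun _ f => f.s1_functor)
    (fun T => T.e21_functor) (fun _ _ _ => rfl) (fun _ f => f.s1_functor.map_e)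
    (fun τ u => congrArg (fun s => s.f1 τ) (FreeCube.shell_mk (Term.e2 u)))
  e23_functor := FreeCube.isFunctor_of_eval FreeCube.eval_functor3 (fun _ f => f.s2_functor)
    (fun T => T.e23_functor) (fun _ _ _ => rfl) (fun _ f => f.s2_functor.map_e)
    (fun τ u => congrArg (fun s => s.f3 τ) (FreeCube.shell_mk (Term.e2 u)))
  e31_functor := FreeCube.isFunctor_of_eval FreeCube.eval_functor1 (fun _ f => f.s1_functor)
    (fun T => T.e31_functor) (fun _ _ _ => rfl) (fun _ f => f.s2_functor.map_e)
    (fun τ u => congrArg (fun s => s.f1 τ) (FreeCube.shell_mk (Term.e3 u)))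
  e32_functor := FreeCube.isFunctor_of_eval FreeCube.eval_functor2 (fun _ f => f.s2_functor)
    (fun T => T.e32_functor) (fun _ _ _ => rfl) (fun _ f => f.s2_functor.map_e)
    (fun τ u => congrArg (fun s => s.f2 τ) (FreeCube.shell_mk (Term.e3 u)))
  interchange12 := FreeCube.interchange_of_eval FreeCube.eval_functor1 FreeCube.eval_functor2
    fun T => T.interchange12
  interchange13 := FreeCube.interchange_of_eval FreeCube.eval_functor1 FreeCube.eval_functor3
    fun T => T.interchange13
  interchange23 := FreeCube.interchange_of_eval FreeCube.eval_functor2 FreeCube.eval_functor3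
    fun T => T.interchange23
  G1 σ u := FreeCube.mk (Term.G1 σ u)
  G2 σ u := FreeCube.mk (Term.G2 σ u)
  G1_conn := FreeCube.isConnectionPair_of_eval (fun _ f => f.s1_functor) FreeCube.eval_functor1
    FreeCube.eval_functor2 (fun _ _ _ _ => rfl) (fun T => T.G1_conn)
    (fun σ u => (congrArg (fun s => s.f1 σ) (FreeCube.shell_mk (Term.G1 σ u))).trans
      (Shell.G1_connectionPair.face_fst σ u))
    (fun σ u => (congrArg (fun s => s.f2 σ) (FreeCube.shell_mk (Term.G1 σ u))).trans
      (Shell.G1_connectionPair.face_snd σ u))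
    (fun σ u => (congrArg (fun s => s.f1 (!σ)) (FreeCube.shell_mk (Term.G1 σ u))).trans
      (Shell.G1_connectionPair.coface_fst σ u))
    (fun σ u => (congrArg (fun s => s.f2 (!σ)) (FreeCube.shell_mk (Term.G1 σ u))).trans
      (Shell.G1_connectionPair.coface_snd σ u))
  G2_conn := FreeCube.isConnectionPair_of_eval (fun _ f => f.s2_functor) FreeCube.eval_functor2
    FreeCube.eval_functor3 (fun _ _ _ _ => rfl) (fun T => T.G2_conn)
    (fun σ u => (congrArg (fun s => s.f2 σ) (FreeCube.shell_mk (Term.G2 σ u))).trans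
      (Shell.G2_connectionPair.face_fst σ u))
    (fun σ u => (congrArg (fun s => s.f3 σ) (FreeCube.shell_mk (Term.G2 σ u))).trans
      (Shell.G2_connectionPair.face_snd σ u))
    (fun σ u => (congrArg (fun s => s.f2 (!σ)) (FreeCube.shell_mk (Term.G2 σ u))).trans
      (Shell.G2_connectionPair.coface_fst σ u))
    (fun σ u => (congrArg (fun s => s.f3 (!σ)) (FreeCube.shell_mk (Term.G2 σ u))).trans
      (Shell.G2_connectionPair.coface_snd σ u))
  G1_functor σ := FreeCube.isFunctor_of_eval FreeCube.eval_functor3 (fun _ f => f.s2_functor)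
    (fun T => T.G1_functor σ) (fun _ _ _ => rfl) (fun _ f => f.map_Γ σ)
    (fun τ u => congrArg (fun s => s.f3 τ) (FreeCube.shell_mk (Term.G1 σ u)))
  G2_functor σ := FreeCube.isFunctor_of_eval FreeCube.eval_functor1 (fun _ f => f.s1_functor)
    (fun T => T.G2_functor σ) (fun _ _ _ => rfl) (fun _ f => f.map_Γ σ)
    (fun τ u => congrArg (fun s => s.f1 τ) (FreeCube.shell_mk (Term.G2 σ u)))
  G1_Γ σ a := FreeCube.ext fun T f => by
    rw [FreeCube.eval_G1, FreeCube.eval_G2, f.map_Γ, T.G1_Γ]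

end DoubleCatConn

/-! ### The universal property, and free cubes over a double groupoid. -/

theorem CatStr.Interchange.symm {A O : Type u} {P Q : CatStr A O} (I : P.Interchange Q) :
    Q.Interchange P :=
  fun a b c d h₁ h₂ h₃ h₄ h₅ h₆ => (I a c b d h₃ h₄ h₁ h₂ h₆ h₅).symm

namespace DoubleCatConn

open CatStr

variable {D : DoubleCatConn.{u}}

namespace FreeCube

/-- Composition of classes was defined through chosen representatives; evaluation shows that the
choice is immaterial. -/
theorem mk_comp1 {α β : Shell D.toDoubleCat} (x : Term D α) (y : Term D β)
    (h : α.f1 true = β.f1 false) : mk (x.comp1 y h) =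
      cat1.comp (mk x) (mk y) (by simpa only [cat1, shell_mk] using h) :=
  ext fun T f => by
    rw [(eval_functor1 T f).map_comp']
    rfl

theorem mk_comp2 {α β : Shell D.toDoubleCat} (x : Term D α) (y : Term D β)
    (h : α.f2 true = β.f2 false) : mk (x.comp2 y h) =
      cat2.comp (mk x) (mk y) (by simpa only [cat2, shell_mk] using h) :=
  ext fun T f => by
    rw [(eval_functor2 T f).map_comp']
    rfl

theorem mk_comp3 {α β : Shell D.toDoubleCat} (x : Term D α) (y : Term D β)
    (h : α.f3 true = β.f3 false) : mk (x.comp3 y h) =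
      cat3.comp (mk x) (mk y) (by simpa only [cat3, shell_mk] using h) :=
  ext fun T f => by
    rw [(eval_functor3 T f).map_comp']
    rfl

end FreeCube

theorem free_induction {p : D.free.K3 → Prop} (e1 : ∀ u, p (D.free.c1.e u))
    (e2 : ∀ u, p (D.free.c2.e u)) (e3 : ∀ u, p (D.free.c3.e u)) (G1 : ∀ σ u, p (D.free.G1 σ u))
    (G2 : ∀ σ u, p (D.free.G2 σ u))
    (comp1 : ∀ x y h, p x → p y → p (D.free.c1.comp x y h))
    (comp2 : ∀ x y h, p x → p y → p (D.free.c2.comp x y h))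
    (comp3 : ∀ x y h, p x → p y → p (D.free.c3.comp x y h)) (x : D.free.K3) : p x := by
  obtain ⟨α, t, rfl⟩ := FreeCube.exists_mk x
  induction t with
  | e1 u => exact e1 u
  | e2 u => exact e2 u
  | e3 u => exact e3 u
  | G1 σ u => exact G1 σ u
  | G2 σ u => exact G2 σ u
  | comp1 x y h hx hy => rw [FreeCube.mk_comp1]; exact comp1 _ _ _ hx hy
  | comp2 x y h hx hy => rw [FreeCube.mk_comp2]; exact comp2 _ _ _ hx hy
  | comp3 x y h hx hy => rw [FreeCube.mk_comp3]; exact comp3 _ _ _ hx hy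

/-- The extension of a morphism of double categories to the free triple category. -/
noncomputable def freeLift {T : TripleCatConn.{u}} (f : DoubleHom D T.toDoubleCatConn) :
    TripleHom D.free T where
  toDoubleHom := f
  map3 := FreeCube.eval f
  c1_functor := FreeCube.eval_functor1 T f
  c2_functor := FreeCube.eval_functor2 T f
  c3_functor := FreeCube.eval_functor3 T f
  map_G1 _ _ := rfl
  map_G2 _ _ := rfl

/-- The 3-cubes are generated by operations on squares, so a morphism out of `D.free` is determined
by its restriction to dimensions at most 2. -/
theorem freeLift_toDoubleHom {T : TripleCatConn.{u}} (F : TripleHom D.free T) :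
    freeLift (D := D) F.toDoubleHom = F := by
  have key : ∀ x, (freeLift (D := D) F.toDoubleHom).map3 x = F.map3 x := by
    refine free_induction (D := D) ?_ ?_ ?_ ?_ ?_ ?_ ?_ ?_
    · exact fun u => (F.c1_functor.map_e u).symm
    · exact fun u => (F.c2_functor.map_e u).symm
    · exact fun u => (F.c3_functor.map_e u).symm
    · exact fun σ u => (F.map_G1 σ u).symm
    · exact fun σ u => (F.map_G2 σ u).symm
    · intro x y h hx hy
      rw [(freeLift (D := D) F.toDoubleHom).c1_functor.map_comp' h, F.c1_functor.map_comp' h]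
      exact T.c1.comp_congr hx hy _ _
    · intro x y h hx hy
      rw [(freeLift (D := D) F.toDoubleHom).c2_functor.map_comp' h, F.c2_functor.map_comp' h]
      exact T.c2.comp_congr hx hy _ _
    · intro x y h hx hy
      rw [(freeLift (D := D) F.toDoubleHom).c3_functor.map_comp' h, F.c3_functor.map_comp' h]
      exact T.c3.comp_congr hx hy _ _
  exact TripleHom.ext rfl rfl rfl (funext key)

/-- The universal property of the free triple category. -/
noncomputable def freeHomEquiv (D : DoubleCatConn.{u}) (T : TripleCatConn.{u}) :
    (D.free ⟶ T) ≃ (D ⟶ tr.obj T) where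
  toFun F := TripleHom.toDoubleHom F
  invFun f := freeLift f
  left_inv F := freeLift_toDoubleHom F
  right_inv _ := rfl

theorem isThin_free (x : D.free.K3) : D.free.IsThin x :=
  free_induction TripleCatConn.isThin_e1 TripleCatConn.isThin_e2 TripleCatConn.isThin_e3
    TripleCatConn.isThin_G1 TripleCatConn.isThin_G2 (fun _ _ h hx hy => hx.comp1 hy h)
    (fun _ _ h hx hy => hx.comp2 hy h) (fun _ _ h hx hy => hx.comp3 hy h) x

/-- Invertibility in all three directions at once is proved by induction on formal composites:
degeneracies and transverse connections are functorial, connections in their own two directions are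
invertible by transport, and interchange shows that composing in one direction preserves inverses in
another. -/
theorem isTripleGroupoid_free (hD : D.IsDoubleGroupoid) : D.free.IsTripleGroupoid := by
  obtain ⟨h₀, h₁, h₂⟩ := hD
  refine ⟨⟨h₀, h₁, h₂⟩, ?_⟩
  rw [isGroupoid_iff] at h₁ h₂
  simp only [isGroupoid_iff, ← forall_and]
  refine free_induction (D := D) ?_ ?_ ?_ ?_ ?_ ?_ ?_ ?_
  · exact fun u => ⟨isInvertible_e u, (h₁ u).map D.free.e12_functor, (h₂ u).map D.free.e13_functor⟩
  · exact fun u => ⟨(h₁ u).map D.free.e21_functor, isInvertible_e u, (h₂ u).map D.free.e23_functor⟩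
  · exact fun u => ⟨(h₁ u).map D.free.e31_functor, (h₂ u).map D.free.e32_functor, isInvertible_e u⟩
  · exact fun σ u => ⟨isInvertible_Γ_fst (K := D.free.dc1) (h₁ u) σ,
      isInvertible_Γ_snd (K := D.free.dc1) (h₁ u) σ, (h₂ u).map (D.free.G1_functor σ)⟩
  · exact fun σ u => ⟨(h₁ u).map (D.free.G2_functor σ),
      isInvertible_Γ_fst (K := D.free.dc2) (h₂ u) σ, isInvertible_Γ_snd (K := D.free.dc2) (h₂ u) σ⟩
  · rintro x y h ⟨x₁, x₂, x₃⟩ ⟨y₁, y₂, y₃⟩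
    exact ⟨x₁.comp y₁ h,
      x₂.comp_transverse D.free.interchange12.symm D.free.d21_functor D.free.d12_functor
        D.free.e21_functor y₂ h,
      x₃.comp_transverse D.free.interchange13.symm D.free.d31_functor D.free.d13_functor
        D.free.e31_functor y₃ h⟩
  · rintro x y h ⟨x₁, x₂, x₃⟩ ⟨y₁, y₂, y₃⟩
    exact ⟨x₁.comp_transverse D.free.interchange12 D.free.d12_functor D.free.d21_functor
        D.free.e12_functor y₁ h,
      x₂.comp y₂ h,
      x₃.comp_transverse D.free.interchange23.symm D.free.d32_functor D.free.d23_functor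
        D.free.e32_functor y₃ h⟩
  · rintro x y h ⟨x₁, x₂, x₃⟩ ⟨y₁, y₂, y₃⟩
    exact ⟨x₁.comp_transverse D.free.interchange13 D.free.d13_functor D.free.d31_functor
        D.free.e13_functor y₁ h,
      x₂.comp_transverse D.free.interchange23 D.free.d23_functor D.free.d32_functor
        D.free.e23_functor y₂ h,
      x₃.comp y₃ h⟩

/-- The shell conditions force the identity faces to be those on the edges of the face in direction
1. -/
theorem _root_.Shell.eq_e1 {α : Shell D.toDoubleCat} (h₁ : α.f1 true = α.f1 false)
    (h₂ : ∀ σ, D.s1.IsIdentity (α.f2 σ)) (h₃ : ∀ σ, D.s1.IsIdentity (α.f3 σ)) :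
    α = Shell.e1 (α.f1 false) := by
  refine Shell.ext' ?_ ?_ ?_ <;> intro σ
  · cases σ
    exacts [rfl, h₁]
  · rw [(h₂ σ).eq false, α.h12]
    rfl
  · rw [(h₃ σ).eq false, α.h13]
    rfl

/-- In the complete folding the faces in directions 2 and 3 are always identities; commutativity
says precisely that the remaining two faces agree. -/
theorem _root_.Shell.IsCommutative.fold_eq {α : Shell D.toDoubleCat} (hα : α.IsCommutative) :
    D.cosk.fold1 (D.cosk.fold2 α) = D.cosk.c1.e α.odd := by
  have h₀ : (D.cosk.fold1 (D.cosk.fold2 α) : Shell D.toDoubleCat).f1 false = α.odd :=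
    (TripleCatConn.odd_shell (T := D.cosk) α).symm
  have h₁ : (D.cosk.fold1 (D.cosk.fold2 α) : Shell D.toDoubleCat).f1 true = α.even :=
    (TripleCatConn.even_shell (T := D.cosk) α).symm
  rw [← h₀]
  exact Shell.eq_e1 (by rw [h₀, h₁, hα])
    (fun σ => TripleCatConn.isIdentity_d2_fold1 (T := D.cosk) σ _)
    (fun σ => TripleCatConn.isIdentity_d3_fold1_fold2 (T := D.cosk) σ α)

/-- Over a double groupoid, every commutative shell is the shell of a free 3-cube. -/
theorem exists_shell_eq (h₁ : D.s1.IsGroupoid) (h₂ : D.s2.IsGroupoid) {α : Shell D.toDoubleCat}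
    (hα : α.IsCommutative) : ∃ x, D.free.shell x = α := by
  -- The starting point is the degenerate free cube on the common composite, whose shell is the
  -- complete folding of `α`. It is unfolded first in directions 1, 2 and then in directions 2, 3;
  -- the edges of `dc1` and `dc2` are squares of `D`, on which `shellHom` is the identity.
  obtain ⟨w, hw⟩ := exists_map_eq_of_map_eq_fold D.free.shellHom.hom1 Function.bijective_id
    h₁ h₁ (y := D.cosk.fold2 α) (z := D.free.c1.e α.odd)
    ((D.free.shellHom.c1_functor.map_e _).trans hα.fold_eq.symm)
  exact exists_map_eq_of_map_eq_fold D.free.shellHom.hom2 Function.bijective_id h₂ h₂ hw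

/-- Over a double groupoid, free 3-cubes are the commutative shells. -/
noncomputable def commutativeShellEquiv (h₁ : D.s1.IsGroupoid) (h₂ : D.s2.IsGroupoid) :
    {α : Shell D.toDoubleCat // α.IsCommutative} ≃ D.free.K3 :=
  (Equiv.ofBijective
    (fun x : D.free.K3 => (⟨D.free.shell x, (isThin_free x).isCommutative_shell⟩ :
      {α : Shell D.toDoubleCat // α.IsCommutative}))
    ⟨fun x y h => (isThin_free x).eq_of_shell_eq h₁ h₂ (isThin_free y) (congrArg Subtype.val h),
      fun ⟨_, hα⟩ => let ⟨x, hx⟩ := exists_shell_eq h₁ h₂ hα; ⟨x, Subtype.ext hx⟩⟩).symm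

theorem shell_commutativeShellEquiv (h₁ : D.s1.IsGroupoid) (h₂ : D.s2.IsGroupoid)
    (α : {α : Shell D.toDoubleCat // α.IsCommutative}) :
    D.free.shell (commutativeShellEquiv h₁ h₂ α) = α.1 :=
  congrArg Subtype.val ((commutativeShellEquiv h₁ h₂).symm_apply_apply α)

end DoubleCatConn

theorem mainTheorem3 :
    ∃ (sk : DoubleCatConn.{u} ⥤ TripleCatConn.{u}) (adj : sk ⊣ tr.{u}),
      ∀ D : DoubleCatConn.{u}, D.IsDoubleGroupoid →
        (sk.obj D).IsTripleGroupoid ∧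
        IsIso (adj.unit.app D) ∧
        ∃ φ : {α : Shell D.toDoubleCat // α.IsCommutative} ≃ (sk.obj D).K3,
          ∀ (α : {α : Shell D.toDoubleCat // α.IsCommutative}) (σ : Bool),
            (sk.obj D).c1.d σ (φ α) = DoubleHom.map2 (adj.unit.app D) (α.1.f1 σ) ∧
            (sk.obj D).c2.d σ (φ α) = DoubleHom.map2 (adj.unit.app D) (α.1.f2 σ) ∧
            (sk.obj D).c3.d σ (φ α) = DoubleHom.map2 (adj.unit.app D) (α.1.f3 σ) := by
  refine ⟨Adjunction.leftAdjointOfEquiv DoubleCatConn.freeHomEquiv fun _ _ _ _ _ => rfl,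
    Adjunction.adjunctionOfEquivLeft DoubleCatConn.freeHomEquiv fun _ _ _ _ _ => rfl,
    fun D hD => ?_⟩
  -- The unit is the transpose of the identity of `D.free`, and transposition merely restricts to
  -- dimensions at most 2.
  have hunit : (Adjunction.adjunctionOfEquivLeft DoubleCatConn.freeHomEquiv
      fun _ _ _ _ _ => rfl).unit.app D = 𝟙 D := by
    rw [← Adjunction.homEquiv_id]
    rfl
  refine ⟨DoubleCatConn.isTripleGroupoid_free hD, ?_,
    DoubleCatConn.commutativeShellEquiv hD.2.1 hD.2.2, fun α σ => ?_⟩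
  · rw [hunit]
    exact inferInstanceAs (IsIso (𝟙 D))
  · rw [hunit]
    have h := DoubleCatConn.shell_commutativeShellEquiv hD.2.1 hD.2.2 α
    exact ⟨congrArg (fun s => s.f1 σ) h, congrArg (fun s => s.f2 σ) h,
      congrArg (fun s => s.f3 σ) h⟩
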